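/- Let $\Bbbk$ be an algebraically closed field of characteristic zero, let $\alpha,\beta,\gamma\in\Bbbk$ with $\beta\neq 0$, and let $A=A(\alpha,\beta,\gamma)$ be the down-up algebra, that is, the $\Bbbk$-algebra generated by $d,u$ subject to the relations $$d^2u=\alpha\, dud+\beta\, ud^2+\gamma\, d,\qquad du^2=\alpha\, udu+\beta\, u^2d+\gamma\, u$$ (the condition $\beta\neq0$ is equivalent to $A$ being noetherian). Suppose that the two roots $r,s$ (with multiplicity) of $x^2-\alpha x-\beta$ in $\Bbbk$ are roots of unity of order at least $2$. Then $A$ is congenial with respect to the standard filtration $\mathcal F$, whose $n$-th step $\mathcal F_n$ is the span of the products of at most $n$ of the generators $d,u$. Here a $\Bbbk$-algebra $A$ with an exhaustive $\mathbb N$-filtration $\mathcal F$ is called congenial if the following hold. Every $\mathcal F_n$ is finite-dimensional, and there are a subring $D\subseteq\Bbbk$ that is finitely generated as a ring and a $D$-subalgebra $A_D\subseteq A$ such that: (1) $A_D$ is an order of $A$, i.e. $A_D$ is free over $D$ and the natural map $A_D\otimes_D\Bbbk\to A$ is an isomorphism; moreover, for the induced filtration $A_D\cap\mathcal F_n$,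 every step is a finitely generated $D$-module; (2) the associated graded ring $\operatorname{gr}_{\mathcal F}A_D$ is an order of $\operatorname{gr}_{\mathcal F}A$ via the natural map; (3) $\operatorname{gr}_{\mathcal F}A_D$ is strongly noetherian over $D$, i.e. $\operatorname{gr}_{\mathcal F}A_D\otimes_D C$ is (left and right) noetherian for every commutative noetherian $D$-algebra $C$, and each of its homogeneous components is a finitely generated $D$-module; (4) for every factor ring $F$ of $D$ that is a finite field, $A_D\otimes_D F$ is a finitely generated, (left and right) noetherian $F$-algebra satisfying a polynomial identity. -/

import Mathlib

open scoped TensorProduct DirectSum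

universe v u w

/-! ### `ℕ`-filtrations -/

/-- An exhaustive, multiplicative, increasing `ℕ`-filtration `F 0 ⊆ F 1 ⊆ ⋯` of an `R`-algebra `A`
by `R`-submodules, with `1 ∈ F 0`. -/
structure NFiltration (R : Type*) (A : Type*) [CommRing R] [Ring A] [Algebra R A] where
  toFun : ℕ → Submodule R A
  mono' : ∀ n, toFun n ≤ toFun (n + 1)
  one_mem' : (1 : A) ∈ toFun 0
  mul_mem' : ∀ {i j : ℕ} {a b : A}, a ∈ toFun i → b ∈ toFun j → a * b ∈ toFun (i + j)
  exhaustive' : ∀ a : A, ∃ n, a ∈ toFun n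

namespace NFiltration

section Basic

variable {R : Type*} {A : Type*} [CommRing R] [Ring A] [Algebra R A]

/-- The standard filtration attached to a set `S` of algebra generators: all elements of `S` are
put in degree one, so the `n`-th step is spanned by the products of at most `n` elements
of `S`. -/
def ofGenerators (S : Set A) (hS : Algebra.adjoin R S = ⊤) : NFiltration R A where
  toFun n := Submodule.span R (insert 1 S) ^ n
  mono' n := by
    rw [pow_succ]
    intro a ha
    have h := Submodule.mul_mem_mul ha
      (Submodule.subset_span (R := R) (Set.mem_insert (1 : A) S))
    rwa [mul_one] at h
  one_mem' := by
    rw [pow_zero]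
    exact Submodule.one_le.mp le_rfl
  mul_mem' ha hb := by
    rw [pow_add]
    exact Submodule.mul_mem_mul ha hb
  exhaustive' a := by
    have hmono : Monotone fun n : ℕ => Submodule.span R (insert (1 : A) S) ^ n := by
      refine monotone_nat_of_le_succ fun n a ha => ?_
      have h := Submodule.mul_mem_mul ha
        (Submodule.subset_span (R := R) (Set.mem_insert (1 : A) S))
      rw [mul_one] at h
      simpa only [pow_succ] using h
    have ha : a ∈ Algebra.adjoin R S := by rw [hS]; trivial
    induction ha using Algebra.adjoin_induction with
    | mem x hx =>
      exact ⟨1, by rw [pow_one]; exact Submodule.subset_span (Set.mem_insert_of_mem _ hx)⟩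
    | algebraMap r =>
      exact ⟨0, by rw [pow_zero]; exact Submodule.algebraMap_mem r⟩
    | add x y _ _ hx hy =>
      obtain ⟨m, hm⟩ := hx
      obtain ⟨n, hn⟩ := hy
      exact ⟨max m n, add_mem (hmono (le_max_left m n) hm) (hmono (le_max_right m n) hn)⟩
    | mul x y _ _ hx hy =>
      obtain ⟨m, hm⟩ := hx
      obtain ⟨n, hn⟩ := hy
      exact ⟨m + n, by rw [pow_add]; exact Submodule.mul_mem_mul hm hn⟩

variable (F : NFiltration R A)

/-- A filtration is locally finite if each of its steps is a finitely generated module. -/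
def IsLocallyFinite : Prop := ∀ n, Module.Finite R (F.toFun n)

/-- The step before the `n`-th one: `F (n - 1)`, with `F (-1) = 0`. -/
def prev : ℕ → Submodule R A
  | 0 => ⊥
  | n + 1 => F.toFun n

lemma mul_mem_prev_left {i j : ℕ} {a b : A} (ha : a ∈ F.prev i) (hb : b ∈ F.toFun j) :
    a * b ∈ F.prev (i + j) := by
  cases i with
  | zero =>
    have h : a = 0 := ha
    rw [h, zero_mul]
    exact zero_mem _
  | succ i =>
    rw [Nat.succ_add]
    exact F.mul_mem' ha hb

lemma mul_mem_prev_right {i j : ℕ} {a b : A} (ha : a ∈ F.toFun i) (hb : b ∈ F.prev j) :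
    a * b ∈ F.prev (i + j) := by
  cases j with
  | zero =>
    have h : b = 0 := hb
    rw [h, mul_zero]
    exact zero_mem _
  | succ j => exact F.mul_mem' ha hb

/-! ### The associated graded ring -/

/-- The degree `n` piece `F n / F (n - 1)` of the associated graded ring. -/
def GrPiece (n : ℕ) : Type _ := F.toFun n ⧸ (F.prev n).submoduleOf (F.toFun n)

instance (n : ℕ) : AddCommGroup (F.GrPiece n) :=
  inferInstanceAs (AddCommGroup (F.toFun n ⧸ (F.prev n).submoduleOf (F.toFun n)))

instance (n : ℕ) : Module R (F.GrPiece n) :=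
  inferInstanceAs (Module R (F.toFun n ⧸ (F.prev n).submoduleOf (F.toFun n)))

/-- The symbol in degree `n` of an element of `F n`. -/
def symbol (n : ℕ) (a : A) (ha : a ∈ F.toFun n) : F.GrPiece n :=
  Submodule.Quotient.mk ⟨a, ha⟩

lemma symbol_surj {n : ℕ} (x : F.GrPiece n) : ∃ a ha, F.symbol n a ha = x := by
  obtain ⟨⟨a, ha⟩, rfl⟩ := Submodule.Quotient.mk_surjective _ x
  exact ⟨a, ha, rfl⟩

lemma symbol_eq_iff {n : ℕ} {a b : A} (ha : a ∈ F.toFun n) (hb : b ∈ F.toFun n) :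
    F.symbol n a ha = F.symbol n b hb ↔ a - b ∈ F.prev n :=
  Submodule.Quotient.eq _

lemma mk_symbol_congr {i j : ℕ} {a b : A} (hij : i = j) (hab : a = b)
    (ha : a ∈ F.toFun i) (hb : b ∈ F.toFun j) :
    GradedMonoid.mk (A := F.GrPiece) i (F.symbol i a ha) =
      GradedMonoid.mk j (F.symbol j b hb) := by
  subst hij hab
  rfl

/-- Multiplication of graded pieces, induced by the multiplication `F i × F j → F (i + j)`. -/
def grMul {i j : ℕ} : F.GrPiece i → F.GrPiece j → F.GrPiece (i + j) :=
  Quotient.map₂ (fun a b => ⟨a.1 * b.1, F.mul_mem' a.2 b.2⟩) (by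
    intro a a' ha b b' hb
    have ha := (Submodule.quotientRel_def ((F.prev i).submoduleOf (F.toFun i))).mp ha
    have hb := (Submodule.quotientRel_def ((F.prev j).submoduleOf (F.toFun j))).mp hb
    change a.1 - a'.1 ∈ F.prev i at ha
    change b.1 - b'.1 ∈ F.prev j at hb
    refine (Submodule.quotientRel_def ((F.prev (i + j)).submoduleOf (F.toFun (i + j)))).mpr ?_
    change a.1 * b.1 - a'.1 * b'.1 ∈ F.prev (i + j)
    have h : a.1 * b.1 - a'.1 * b'.1 = (a.1 - a'.1) * b.1 + a'.1 * (b.1 - b'.1) := by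
      noncomm_ring
    rw [h]
    exact add_mem (F.mul_mem_prev_left ha b.2) (F.mul_mem_prev_right a'.2 hb))

lemma grMul_symbol {i j : ℕ} {a b : A} (ha : a ∈ F.toFun i) (hb : b ∈ F.toFun j) :
    F.grMul (F.symbol i a ha) (F.symbol j b hb) = F.symbol (i + j) (a * b) (F.mul_mem' ha hb) :=
  rfl

lemma symbol_add {n : ℕ} {a b : A} (ha : a ∈ F.toFun n) (hb : b ∈ F.toFun n) :
    F.symbol n a ha + F.symbol n b hb = F.symbol n (a + b) (add_mem ha hb) :=
  rfl

lemma symbol_zero (n : ℕ) : (0 : F.GrPiece n) = F.symbol n 0 (zero_mem _) :=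
  rfl

lemma symbol_smul {n : ℕ} (r : R) {a : A} (ha : a ∈ F.toFun n) :
    r • F.symbol n a ha = F.symbol n (r • a) (Submodule.smul_mem _ r ha) :=
  rfl

lemma algebraMap_mem_zero (r : R) : algebraMap R A r ∈ F.toFun 0 := by
  rw [Algebra.algebraMap_eq_smul_one]
  exact Submodule.smul_mem _ r F.one_mem'

instance grGMul : GradedMonoid.GMul F.GrPiece where
  mul := F.grMul

instance grGOne : GradedMonoid.GOne F.GrPiece where
  one := F.symbol 0 1 F.one_mem'

instance grGMonoid : GradedMonoid.GMonoid F.GrPiece where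
  one_mul := by
    rintro ⟨i, x⟩
    obtain ⟨a, ha, rfl⟩ := F.symbol_surj x
    exact F.mk_symbol_congr (zero_add i) (one_mul a) _ _
  mul_one := by
    rintro ⟨i, x⟩
    obtain ⟨a, ha, rfl⟩ := F.symbol_surj x
    exact F.mk_symbol_congr (add_zero i) (mul_one a) _ _
  mul_assoc := by
    rintro ⟨i, x⟩ ⟨j, y⟩ ⟨k, z⟩
    obtain ⟨a, ha, rfl⟩ := F.symbol_surj x
    obtain ⟨b, hb, rfl⟩ := F.symbol_surj y
    obtain ⟨c, hc, rfl⟩ := F.symbol_surj z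
    exact F.mk_symbol_congr (add_assoc i j k) (mul_assoc a b c) _ _

instance grGSemiring : DirectSum.GSemiring F.GrPiece where
  __ := F.grGMonoid
  mul_zero {i j} x := by
    obtain ⟨a, ha, rfl⟩ := F.symbol_surj x
    exact (F.symbol_eq_iff _ (zero_mem _)).mpr (by simp)
  zero_mul {i j} x := by
    obtain ⟨a, ha, rfl⟩ := F.symbol_surj x
    exact (F.symbol_eq_iff _ (zero_mem _)).mpr (by simp)
  mul_add {i j} x y z := by
    obtain ⟨a, ha, rfl⟩ := F.symbol_surj x
    obtain ⟨b, hb, rfl⟩ := F.symbol_surj y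
    obtain ⟨c, hc, rfl⟩ := F.symbol_surj z
    exact (F.symbol_eq_iff _ (add_mem (F.mul_mem' ha hb) (F.mul_mem' ha hc))).mpr (by
      simp [mul_add])
  add_mul {i j} x y z := by
    obtain ⟨a, ha, rfl⟩ := F.symbol_surj x
    obtain ⟨b, hb, rfl⟩ := F.symbol_surj y
    obtain ⟨c, hc, rfl⟩ := F.symbol_surj z
    exact (F.symbol_eq_iff _ (add_mem (F.mul_mem' ha hc) (F.mul_mem' hb hc))).mpr (by
      simp [add_mul])
  natCast n := n • F.symbol 0 1 F.one_mem'
  natCast_zero := zero_nsmul _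
  natCast_succ n := succ_nsmul _ n

instance grGRing : DirectSum.GRing F.GrPiece where
  intCast n := n • F.symbol 0 1 F.one_mem'
  intCast_ofNat n := natCast_zsmul _ n
  intCast_negSucc_ofNat n := negSucc_zsmul _ n

instance grGAlgebra : DirectSum.GAlgebra R F.GrPiece where
  toFun :=
    { toFun := fun r => F.symbol 0 (algebraMap R A r) (F.algebraMap_mem_zero r)
      map_zero' := by
        rw [symbol_zero, symbol_eq_iff]
        simp
      map_add' := fun r s => by
        rw [symbol_add, symbol_eq_iff]
        simp }
  map_one := by
    change F.symbol 0 (algebraMap R A 1) _ = F.symbol 0 1 F.one_mem'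
    rw [symbol_eq_iff]
    simp
  map_mul r s := F.mk_symbol_congr (add_zero 0).symm (map_mul (algebraMap R A) r s) _
    (F.mul_mem' (F.algebraMap_mem_zero r) (F.algebraMap_mem_zero s))
  commutes := by
    rintro r ⟨i, x⟩
    obtain ⟨a, ha, rfl⟩ := F.symbol_surj x
    exact F.mk_symbol_congr ((zero_add i).trans (add_zero i).symm) (Algebra.commutes r a)
      (F.mul_mem' (F.algebraMap_mem_zero r) ha) (F.mul_mem' ha (F.algebraMap_mem_zero r))
  smul_def := by
    rintro r ⟨i, x⟩
    obtain ⟨a, ha, rfl⟩ := F.symbol_surj x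
    exact F.mk_symbol_congr (zero_add i).symm (Algebra.smul_def r a)
      (Submodule.smul_mem _ r ha) (F.mul_mem' (F.algebraMap_mem_zero r) ha)

/-- The associated graded ring `gr_F A = ⨁ₙ F n / F (n - 1)`. -/
def AssocGraded : Type _ := ⨁ n, F.GrPiece n

noncomputable instance : Ring F.AssocGraded := inferInstanceAs (Ring (⨁ n, F.GrPiece n))

noncomputable instance : Algebra R F.AssocGraded :=
  inferInstanceAs (Algebra R (⨁ n, F.GrPiece n))

/-- The inclusion of the degree `n` piece in the associated graded ring. -/
noncomputable def grOf (n : ℕ) : F.GrPiece n →ₗ[R] F.AssocGraded :=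
  DirectSum.lof R ℕ F.GrPiece n

lemma grOf_mul {i j : ℕ} (x : F.GrPiece i) (y : F.GrPiece j) :
    F.grOf i x * F.grOf j y = F.grOf (i + j) (F.grMul x y) :=
  DirectSum.of_mul_of x y

lemma grOf_one : F.grOf 0 (F.symbol 0 1 F.one_mem') = 1 :=
  rfl

end Basic

/-! ### Induced filtrations on subalgebras over a subring of the base field -/

section Induced

variable {𝕜 : Type*} [Field 𝕜] {A : Type*} [Ring A] [Algebra 𝕜 A]

/-- The filtration induced on a `D`-subalgebra `B` of `A`: its `n`-th step is `B ∩ F n`. -/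
def induced (F : NFiltration 𝕜 A) {D : Subring 𝕜} (B : Subalgebra D A) : NFiltration D B where
  toFun n := ((F.toFun n).restrictScalars D).comap B.val.toLinearMap
  mono' n _ ha := F.mono' n ha
  one_mem' := F.one_mem'
  mul_mem' ha hb := F.mul_mem' ha hb
  exhaustive' a := F.exhaustive' (a : A)

lemma mem_induced (F : NFiltration 𝕜 A) {D : Subring 𝕜} (B : Subalgebra D A) (n : ℕ) (a : B) :
    a ∈ (F.induced B).toFun n ↔ (a : A) ∈ F.toFun n :=
  Iff.rfl

lemma mem_induced_prev (F : NFiltration 𝕜 A) {D : Subring 𝕜} (B : Subalgebra D A) (n : ℕ) (a : B) :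
    a ∈ (F.induced B).prev n ↔ (a : A) ∈ F.prev n := by
  cases n with
  | zero => exact ⟨fun h => congrArg Subtype.val h, fun h => Subtype.ext h⟩
  | succ n => exact Iff.rfl

/-- The canonical map `(B ∩ F n) / (B ∩ F (n - 1)) → F n / F (n - 1) ⊆ gr_F A`. -/
noncomputable def grPieceMap (F : NFiltration 𝕜 A) {D : Subring 𝕜} (B : Subalgebra D A) (n : ℕ) :
    (F.induced B).GrPiece n →ₗ[D] F.AssocGraded :=
  Submodule.liftQ _
    { toFun := fun a => F.grOf n (F.symbol n (a.1 : A) ((F.mem_induced B n a.1).mp a.2))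
      map_add' := fun a b => by
        rw [← map_add]
        rfl
      map_smul' := fun c a => by
        change _ = (c : 𝕜) • F.grOf n (F.symbol n (a.1 : A) ((F.mem_induced B n a.1).mp a.2))
        rw [← map_smul]
        rfl } (by
    intro a ha
    have h : (a.1 : A) ∈ F.prev n := (F.mem_induced_prev B n a.1).mp ha
    rw [LinearMap.mem_ker]
    change F.grOf n (F.symbol n (a.1 : A) ((F.mem_induced B n a.1).mp a.2)) = 0
    have h0 : F.symbol n (a.1 : A) ((F.mem_induced B n a.1).mp a.2) = 0 := by
      rw [symbol_zero, symbol_eq_iff, sub_zero]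
      exact h
    rw [h0, map_zero])

/-- The canonical homomorphism of graded rings `gr_F B → gr_F A`, where `B` carries the induced
filtration. -/
noncomputable def grMap (F : NFiltration 𝕜 A) {D : Subring 𝕜} (B : Subalgebra D A) :
    (F.induced B).AssocGraded →ₐ[D] F.AssocGraded :=
  DirectSum.toAlgebra D (F.induced B).GrPiece (F.grPieceMap B) F.grOf_one (by
    intro i j x y
    obtain ⟨a, ha, rfl⟩ := (F.induced B).symbol_surj x
    obtain ⟨b, hb, rfl⟩ := (F.induced B).symbol_surj y
    exact (F.grOf_mul (F.symbol i (a : A) ((F.mem_induced B i a).mp ha))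
      (F.symbol j (b : A) ((F.mem_induced B j b).mp hb))).symm)

lemma grMap_grOf_symbol (F : NFiltration 𝕜 A) {D : Subring 𝕜} (B : Subalgebra D A) (n : ℕ) (a : B)
    (ha : a ∈ (F.induced B).toFun n) :
    F.grMap B ((F.induced B).grOf n ((F.induced B).symbol n a ha)) =
      F.grOf n (F.symbol n (a : A) ((F.mem_induced B n a).mp ha)) :=
  DirectSum.toModule_lof D n _

end Induced

end NFiltration

/-! ### Ring-theoretic notions for noncommutative algebras -/

/-- A ring is noetherian if it is both left and right noetherian. -/
def IsLeftRightNoetherian (B : Type*) [Ring B] : Prop :=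
  IsNoetherianRing B ∧ IsNoetherianRing Bᵐᵒᵖ

/-- An `R`-algebra `B` is strongly noetherian if `B ⊗[R] C` is noetherian for every commutative
noetherian `R`-algebra `C`. -/
def IsStronglyNoetherian (R : Type u) (B : Type w) [CommRing R] [Ring B] [Algebra R B] :
    Prop :=
  ∀ (C : Type v) [CommRing C] [Algebra R C], IsNoetherianRing C → IsLeftRightNoetherian (B ⊗[R] C)

/-- An algebra `B` over a field `K` is PI if some nonzero noncommutative polynomial over `K`
vanishes under all substitutions of elements of `B` for the variables. -/
def IsPIAlgebra (K : Type*) (B : Type*) [CommRing K] [Ring B] [Algebra K B] : Prop :=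
  ∃ p : FreeAlgebra K ℕ, p ≠ 0 ∧ ∀ x : ℕ → B, FreeAlgebra.lift K x p = 0

/-- A homomorphism `f : B → A` of `D`-algebras, where `D ⊆ 𝕜` and `A` is a `𝕜`-algebra, identifies
`B` with an order of `A`: `f` is injective, `B` is free over `D`, and the natural map
`𝕜 ⊗[D] B → A` is bijective. -/
def IsOrderMap {𝕜 : Type*} [Field 𝕜] {D : Subring 𝕜} {A B : Type*} [Ring A] [Algebra 𝕜 A]
    [Ring B] [Algebra D B] (f : B →ₐ[D] A) : Prop :=
  Function.Injective f ∧ Module.Free D B ∧ IsBaseChange 𝕜 f.toLinearMap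

/-- A `D`-subalgebra `B` of a `𝕜`-algebra `A` is an order of `A`. -/
def IsOrder {𝕜 : Type*} [Field 𝕜] {D : Subring 𝕜} {A : Type*} [Ring A] [Algebra 𝕜 A]
    (B : Subalgebra D A) : Prop :=
  IsOrderMap B.val

/-! ### Congenial algebras -/

/-- The conditions in the definition of congeniality that involve a subring `D` of `𝕜` and a
`D`-subalgebra `B` of `A`. -/
structure IsCongenialOrder {𝕜 : Type u} [Field 𝕜] {A : Type w} [Ring A] [Algebra 𝕜 A]
    (F : NFiltration 𝕜 A) {D : Subring 𝕜} (B : Subalgebra D A) : Prop where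
  /-- `D` is a finitely generated ring, i.e. affine over the prime ring. -/
  affine : Algebra.FiniteType ℤ D
  order : IsOrder B
  locallyFinite : (F.induced B).IsLocallyFinite
  gr_order : IsOrderMap (F.grMap B)
  gr_stronglyNoetherian : IsStronglyNoetherian.{v} D (F.induced B).AssocGraded
  gr_locallyFinite : ∀ n, Module.Finite D ((F.induced B).GrPiece n)
  affine_residue : ∀ I : Ideal D, IsField (D ⧸ I) → Finite (D ⧸ I) →
    Algebra.FiniteType (D ⧸ I) ((D ⧸ I) ⊗[D] B)
  noetherian_residue : ∀ I : Ideal D, IsField (D ⧸ I) → Finite (D ⧸ I) →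
    IsLeftRightNoetherian ((D ⧸ I) ⊗[D] B)
  pi_residue : ∀ I : Ideal D, IsField (D ⧸ I) → Finite (D ⧸ I) →
    IsPIAlgebra (D ⧸ I) ((D ⧸ I) ⊗[D] B)

/-- A `𝕜`-algebra `A` is congenial for the filtration `F`. -/
def IsCongenial {𝕜 : Type u} [Field 𝕜] {A : Type w} [Ring A] [Algebra 𝕜 A]
    (F : NFiltration 𝕜 A) : Prop :=
  F.IsLocallyFinite ∧ ∃ (D : Subring 𝕜) (B : Subalgebra D A), IsCongenialOrder.{v} F B

/-! ### Down-up algebras -/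

/-- The two generators of a down-up algebra. -/
inductive DownUpGen : Type
  | d : DownUpGen
  | u : DownUpGen

namespace FreeDownUp

/-- The free generator `d`. -/
abbrev d (R : Type*) [CommRing R] : FreeAlgebra R DownUpGen := FreeAlgebra.ι R DownUpGen.d

/-- The free generator `u`. -/
abbrev u (R : Type*) [CommRing R] : FreeAlgebra R DownUpGen := FreeAlgebra.ι R DownUpGen.u

end FreeDownUp

open FreeDownUp in
/-- The defining relations `d²u = α dud + β ud² + γ d` and `du² = α udu + β u²d + γ u` of the
down-up algebra `A(α, β, γ)`. -/
inductive DownUpRel {R : Type*} [CommRing R] (α β γ : R) :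
    FreeAlgebra R DownUpGen → FreeAlgebra R DownUpGen → Prop
  | ddu : DownUpRel α β γ (d R ^ 2 * u R)
      (α • (d R * u R * d R) + β • (u R * d R ^ 2) + γ • d R)
  | duu : DownUpRel α β γ (d R * u R ^ 2)
      (α • (u R * d R * u R) + β • (u R ^ 2 * d R) + γ • u R)

/-- The down-up algebra `A(α, β, γ)` over `R`. -/
abbrev DownUpAlgebra {R : Type*} [CommRing R] (α β γ : R) : Type _ := RingQuot (DownUpRel α β γ)

namespace DownUpAlgebra

variable {R : Type*} [CommRing R] (α β γ : R)

/-- The generator `d`. -/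
noncomputable def d : DownUpAlgebra α β γ :=
  RingQuot.mkAlgHom R (DownUpRel α β γ) (FreeAlgebra.ι R DownUpGen.d)

/-- The generator `u`. -/
noncomputable def u : DownUpAlgebra α β γ :=
  RingQuot.mkAlgHom R (DownUpRel α β γ) (FreeAlgebra.ι R DownUpGen.u)

lemma adjoin_d_u : Algebra.adjoin R {d α β γ, u α β γ} = ⊤ := by
  have h : ({d α β γ, u α β γ} : Set (DownUpAlgebra α β γ)) =
      RingQuot.mkAlgHom R (DownUpRel α β γ) '' Set.range (FreeAlgebra.ι R) := by
    ext x
    constructor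
    · rintro (rfl | rfl)
      · exact ⟨_, ⟨DownUpGen.d, rfl⟩, rfl⟩
      · exact ⟨_, ⟨DownUpGen.u, rfl⟩, rfl⟩
    · rintro ⟨_, ⟨g, rfl⟩, rfl⟩
      cases g
      · exact Or.inl rfl
      · exact Or.inr rfl
  rw [h, Algebra.adjoin_image, FreeAlgebra.adjoin_range_ι, Algebra.map_top]
  exact (AlgHom.range_eq_top _).mpr (RingQuot.mkAlgHom_surjective R _)

/-- The standard filtration of a down-up algebra, with `d` and `u` in degree one. -/
noncomputable def standardFiltration : NFiltration R (DownUpAlgebra α β γ) :=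
  NFiltration.ofGenerators {d α β γ, u α β γ} (adjoin_d_u α β γ)

end DownUpAlgebra

/-! Put x = ud and y = du. The two relations force x and y to commute, and they say precisely that d
p = σ(p) d and p u = u σ(p) for every polynomial p in x and y, where σ sends x to y and y to αy + βx
+ γ. Since β is invertible, σ is an automorphism (`downUpTwist`). Everything is proved for a pair of
generators satisfying the relations over an arbitrary commutative ring (`IsDownUpPair`), so that it
applies at once to the integral form, its associated graded ring and their base changes.

Noetherianity: the algebra arises from a quotient of R[x, y] by adjoining u and then d, each
normalizing the preceding ring, so a Hilbert basis argument applies twice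
(`IsNoetherianRing.of_adjoin_normalizing`).

Basis: the monomials xⁱ yʲ t_k, with t_k a power of d or of u, span compatibly with degree because σ
does not raise degrees (`span_pow_eq`). They are independent because the algebra acts on functions
from ℤ to polynomials by a shift and a weighted shift (`linearIndependent_monom`).

Polynomial identity: over a finite ring σ has finite order N, so dᴺ, uᴺ and the σ-invariant
polynomials are central. The algebra is then finite over its centre and satisfies a standard
identity (`isPIAlgebra`).

Congeniality: take D = ℤ[α, β, β⁻¹, γ] and the D-subalgebra generated by d and u. The same monomials
form a basis over D and over the field, adapted to both filtrations, so their symbols are bases of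
both graded rings. The graded D-algebra is again generated by a down-up pair, now with γ = 0
(`isCongenialOrder`). -/

/-! ### A noncommutative Hilbert basis theorem -/

namespace NoncommHilbert

variable {R S : Type*} [Ring R] [Ring S] (f : R →+* S) (x : S)

/-- The additive subgroup of all sums `∑ i < n, x ^ i * f (r i)`. -/
def polyLT : ℕ → AddSubgroup S
  | 0 => ⊥
  | n + 1 => polyLT n ⊔ ((AddMonoidHom.mulLeft (x ^ n)).comp f.toAddMonoidHom).range

lemma mem_polyLT_succ {n : ℕ} {s : S} :
    s ∈ polyLT f x (n + 1) ↔ ∃ v ∈ polyLT f x n, ∃ r, s = v + x ^ n * f r := by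
  simp only [polyLT, AddSubgroup.mem_sup, AddMonoidHom.mem_range]
  constructor
  · rintro ⟨v, hv, _, ⟨r, rfl⟩, rfl⟩
    exact ⟨v, hv, r, rfl⟩
  · rintro ⟨v, hv, r, rfl⟩
    exact ⟨v, hv, _, ⟨r, rfl⟩, rfl⟩

lemma polyLT_mono : Monotone (polyLT f x) :=
  monotone_nat_of_le_succ fun _ => le_sup_left

lemma pow_mul_mem_polyLT (n : ℕ) (r : R) : x ^ n * f r ∈ polyLT f x (n + 1) :=
  (mem_polyLT_succ f x).mpr ⟨0, zero_mem _, r, by simp⟩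

lemma polyLT_mul_coeff {n : ℕ} {v : S} (hv : v ∈ polyLT f x n) (r : R) :
    v * f r ∈ polyLT f x n := by
  induction n generalizing v with
  | zero =>
    have h : v = 0 := hv
    simp [h]
  | succ n ih =>
    obtain ⟨v, hv', t, rfl⟩ := (mem_polyLT_succ f x).mp hv
    exact (mem_polyLT_succ f x).mpr ⟨v * f r, ih hv', t * r, by rw [map_mul]; noncomm_ring⟩

lemma x_mul_polyLT {n : ℕ} {v : S} (hv : v ∈ polyLT f x n) : x * v ∈ polyLT f x (n + 1) := by
  induction n generalizing v with
  | zero =>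
    have h : v = 0 := hv
    simp [h]
  | succ n ih =>
    obtain ⟨v, hv', t, rfl⟩ := (mem_polyLT_succ f x).mp hv
    exact (mem_polyLT_succ f x).mpr ⟨x * v, ih hv', t, by rw [pow_succ']; noncomm_ring⟩

variable {f x}

lemma polyLT_mul_x (h₂ : ∀ r, ∃ a b, f r * x = x * f a + f b) {n : ℕ} {v : S}
    (hv : v ∈ polyLT f x n) : v * x ∈ polyLT f x (n + 1) := by
  induction n generalizing v with
  | zero =>
    have h : v = 0 := hv
    simp [h]
  | succ n ih =>
    obtain ⟨v, hv', t, rfl⟩ := (mem_polyLT_succ f x).mp hv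
    obtain ⟨a, b, hab⟩ := h₂ t
    refine (mem_polyLT_succ f x).mpr ⟨v * x + x ^ n * f b,
      add_mem (ih hv') (pow_mul_mem_polyLT f x n b), a, ?_⟩
    rw [add_mul, mul_assoc, hab, pow_succ]
    noncomm_ring

/-- Moving a coefficient to the right of a power of `x` only creates errors of lower degree, so
`polyLT`, defined with coefficients on the right, is also stable under coefficients from the left.
-/
lemma coeff_mul_pow (h₂ : ∀ r, ∃ a b, f r * x = x * f a + f b) (n : ℕ) (r : R) :
    ∃ a, ∃ v ∈ polyLT f x n, f r * x ^ n = x ^ n * f a + v := by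
  induction n with
  | zero => exact ⟨r, 0, zero_mem _, by simp⟩
  | succ n ih =>
    obtain ⟨a, v, hv, h⟩ := ih
    obtain ⟨a', b, hab⟩ := h₂ a
    refine ⟨a', x ^ n * f b + v * x,
      add_mem (pow_mul_mem_polyLT f x n b) (polyLT_mul_x h₂ hv), ?_⟩
    rw [pow_succ, ← mul_assoc, h, add_mul, mul_assoc, hab]
    noncomm_ring

lemma coeff_mul_polyLT (h₂ : ∀ r, ∃ a b, f r * x = x * f a + f b) {n : ℕ} {v : S}
    (hv : v ∈ polyLT f x n) (r : R) : f r * v ∈ polyLT f x n := by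
  induction n generalizing v with
  | zero =>
    have h : v = 0 := hv
    simp [h]
  | succ n ih =>
    obtain ⟨v, hv', t, rfl⟩ := (mem_polyLT_succ f x).mp hv
    obtain ⟨a, w, hw, h⟩ := coeff_mul_pow h₂ n r
    refine (mem_polyLT_succ f x).mpr ⟨f r * v + w * f t,
      add_mem (ih hv') (polyLT_mul_coeff f x hw t), a * t, ?_⟩
    rw [mul_add, ← mul_assoc, h, map_mul]
    noncomm_ring

/-- The opposite exchange: it supplies the left multiplier that turns a leading coefficient `r` into
`t * r`, which makes leading coefficients a left ideal. -/
lemma pow_mul_coeff (h₁ : ∀ r, ∃ a b, x * f r = f a * x + f b)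
    (h₂ : ∀ r, ∃ a b, f r * x = x * f a + f b) (n : ℕ) (r : R) :
    ∃ a, ∃ v ∈ polyLT f x n, x ^ n * f r = f a * x ^ n + v := by
  induction n generalizing r with
  | zero => exact ⟨r, 0, zero_mem _, by simp⟩
  | succ n ih =>
    obtain ⟨a, b, hab⟩ := h₁ r
    obtain ⟨a', v, hv, h⟩ := ih a
    refine ⟨a', v * x + x ^ n * f b,
      add_mem (polyLT_mul_x h₂ hv) (pow_mul_mem_polyLT f x n b), ?_⟩
    rw [pow_succ, mul_assoc, hab, mul_add, ← mul_assoc, h]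
    noncomm_ring

lemma exists_mem_polyLT (h₂ : ∀ r, ∃ a b, f r * x = x * f a + f b)
    (hgen : Subring.closure (insert x (Set.range f)) = ⊤) (s : S) : ∃ n, s ∈ polyLT f x n := by
  -- Closure induction handles products once the claim concerns left multiplication by `s`; the
  -- lemma is the case `v = 1`.
  have key : ∀ s ∈ Subring.closure (insert x (Set.range f)),
      ∀ n, ∀ v ∈ polyLT f x n, ∃ m, s * v ∈ polyLT f x m := by
    intro s hs
    induction hs using Subring.closure_induction with
    | mem s hs =>
      intro n v hv
      rcases hs with rfl | ⟨r, rfl⟩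
      · exact ⟨_, x_mul_polyLT f s hv⟩
      · exact ⟨_, coeff_mul_polyLT h₂ hv r⟩
    | zero => exact fun n v _ => ⟨n, by simp⟩
    | one => exact fun n v hv => ⟨n, by simpa using hv⟩
    | add s t _ _ hs ht =>
      intro n v hv
      obtain ⟨m, hm⟩ := hs n v hv
      obtain ⟨k, hk⟩ := ht n v hv
      refine ⟨max m k, ?_⟩
      rw [add_mul]
      exact add_mem (polyLT_mono f x (le_max_left m k) hm) (polyLT_mono f x (le_max_right m k) hk)
    | neg s _ hs =>
      intro n v hv
      obtain ⟨m, hm⟩ := hs n v hv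
      exact ⟨m, by rw [neg_mul]; exact neg_mem hm⟩
    | mul s t _ _ hs ht =>
      intro n v hv
      obtain ⟨m, hm⟩ := ht n v hv
      obtain ⟨k, hk⟩ := hs m _ hm
      exact ⟨k, by rwa [mul_assoc]⟩
  obtain ⟨m, hm⟩ := key s (by rw [hgen]; trivial) 1 1
    (by simpa using pow_mul_mem_polyLT f x 0 1)
  exact ⟨m, by simpa using hm⟩

/-- The left ideal of leading coefficients of the elements of degree at most `n` of a left
ideal. -/
def leadingIdeal (h₁ : ∀ r, ∃ a b, x * f r = f a * x + f b)
    (h₂ : ∀ r, ∃ a b, f r * x = x * f a + f b) (I : Ideal S) (n : ℕ) : Ideal R where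
  carrier := {r | ∃ v ∈ polyLT f x n, x ^ n * f r + v ∈ I}
  zero_mem' := ⟨0, zero_mem _, by simp⟩
  add_mem' := by
    rintro r r' ⟨v, hv, h⟩ ⟨v', hv', h'⟩
    refine ⟨v + v', add_mem hv hv', ?_⟩
    convert add_mem h h' using 1
    rw [map_add]
    noncomm_ring
  smul_mem' := by
    rintro t r ⟨v, hv, h⟩
    obtain ⟨a, w, hw, hh⟩ := pow_mul_coeff h₁ h₂ n t
    -- From xⁿ f(t) = f(a) xⁿ + w one gets f(a)(xⁿ f(r) + v) = xⁿ f(tr) + (f(a) v − w f(r)).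
    refine ⟨f a * v - w * f r,
      sub_mem (coeff_mul_polyLT h₂ hv a) (polyLT_mul_coeff f x hw r), ?_⟩
    convert I.mul_mem_left (f a) h using 1
    rw [smul_eq_mul, map_mul, ← mul_assoc, hh]
    noncomm_ring

/-- Left multiplication by `x` raises the degree and leaves the leading coefficient alone, as
coefficients stand on the right. -/
lemma leadingIdeal_mono (h₁ : ∀ r, ∃ a b, x * f r = f a * x + f b)
    (h₂ : ∀ r, ∃ a b, f r * x = x * f a + f b) {I J : Ideal S} (hIJ : I ≤ J) {m n : ℕ}
    (hmn : m ≤ n) : leadingIdeal h₁ h₂ I m ≤ leadingIdeal h₁ h₂ J n := by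
  have step : Monotone (leadingIdeal h₁ h₂ I) := by
    refine monotone_nat_of_le_succ fun n r => ?_
    rintro ⟨v, hv, h⟩
    refine ⟨x * v, x_mul_polyLT f x hv, ?_⟩
    convert I.mul_mem_left x h using 1
    rw [pow_succ']
    noncomm_ring
  refine (step hmn).trans ?_
  rintro r ⟨v, hv, h⟩
  exact ⟨v, hv, hIJ h⟩

/-- Subtracting from an element of `J` an element of `I` with the same leading coefficient lowers
the degree; induction finishes. Expansions in powers of `x` need not be unique. -/
lemma eq_of_leadingIdeal_eq (h₁ : ∀ r, ∃ a b, x * f r = f a * x + f b)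
    (h₂ : ∀ r, ∃ a b, f r * x = x * f a + f b)
    (hgen : Subring.closure (insert x (Set.range f)) = ⊤) {I J : Ideal S} (hIJ : I ≤ J)
    (h : ∀ n, leadingIdeal h₁ h₂ I n = leadingIdeal h₁ h₂ J n) : I = J := by
  have key : ∀ n, ∀ s ∈ J, s ∈ polyLT f x n → s ∈ I := by
    intro n
    induction n with
    | zero =>
      intro s _ hs
      have h : s = 0 := hs
      simp [h]
    | succ n ih =>
      intro s hs hsn
      obtain ⟨v, hv, r, rfl⟩ := (mem_polyLT_succ f x).mp hsn
      have hr : r ∈ leadingIdeal h₁ h₂ J n := ⟨v, hv, by rwa [add_comm]⟩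
      rw [← h n] at hr
      obtain ⟨w, hw, hI⟩ := hr
      have hvw : v - w ∈ I := by
        refine ih _ ?_ (sub_mem hv hw)
        convert sub_mem hs (hIJ hI) using 1
        abel
      convert add_mem hvw hI using 1
      abel
  refine le_antisymm hIJ fun s hs => ?_
  obtain ⟨n, hn⟩ := exists_mem_polyLT h₂ hgen s
  exact key n s hs hn

end NoncommHilbert

open NoncommHilbert in
/-- A ring generated by a left noetherian ring `R` and an element `x` such that
`x R + R = R x + R` is left noetherian. -/
theorem IsNoetherianRing.of_adjoin_normalizing {R S : Type*} [Ring R] [Ring S]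
    [IsNoetherianRing R] (f : R →+* S) (x : S) (h₁ : ∀ r, ∃ a b, x * f r = f a * x + f b)
    (h₂ : ∀ r, ∃ a b, f r * x = x * f a + f b)
    (hgen : Subring.closure (insert x (Set.range f)) = ⊤) : IsNoetherianRing S := by
  refine monotone_stabilizes_iff_noetherian.mp fun I => ?_
  let L := leadingIdeal h₁ h₂
  -- The ideals `L (I k) n` increase in both indices. The diagonal stabilizes at `N`, which settles
  -- every degree `n ≥ N` by squeezing; each of the finitely many degrees below `N` stabilizes on
  -- its own.
  obtain ⟨N, hN⟩ := monotone_stabilizes_iff_noetherian.mpr ‹IsNoetherianRing R›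
    ⟨fun k => L (I k) k, fun a b hab => leadingIdeal_mono h₁ h₂ (I.monotone hab) hab⟩
  have hcol : ∀ n, ∃ K, ∀ k, K ≤ k → L (I K) n = L (I k) n := fun n =>
    monotone_stabilizes_iff_noetherian.mpr ‹IsNoetherianRing R›
      ⟨fun k => L (I k) n, fun a b hab => leadingIdeal_mono h₁ h₂ (I.monotone hab) le_rfl⟩
  choose K hK using hcol
  let M := max N ((Finset.range N).sup K)
  refine ⟨M, fun k hk => eq_of_leadingIdeal_eq h₁ h₂ hgen (I.monotone hk) fun n => ?_⟩
  rcases lt_or_ge n N with hn | hn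
  · have hKM : K n ≤ M :=
      (Finset.le_sup (f := K) (Finset.mem_range.mpr hn)).trans (le_max_right _ _)
    exact (hK n M hKM).symm.trans (hK n k (hKM.trans hk))
  · have hconst : ∀ j, N ≤ j → L (I j) n = L (I N) N := by
      intro j hj
      refine le_antisymm ?_ (leadingIdeal_mono h₁ h₂ (I.monotone hj) hn)
      refine (leadingIdeal_mono h₁ h₂ (I.monotone (le_max_left j n)) (le_max_right j n)).trans ?_
      exact (hN (max j n) (hj.trans (le_max_left _ _))).ge
    exact (hconst M (le_max_left _ _)).trans (hconst k ((le_max_left _ _).trans hk)).symm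

/-- The version of `IsNoetherianRing.of_adjoin_normalizing` for subrings of a given ring, where the
normalizing condition is only required for generators. -/
theorem Subring.isNoetherianRing_closure_insert {S : Type*} [Ring S] (R : Subring S)
    [IsNoetherianRing R] (x : S) (s : Set S) (hs : R = Subring.closure s)
    (h₁ : ∀ r ∈ s, ∃ a ∈ R, ∃ b ∈ R, x * r = a * x + b)
    (h₂ : ∀ r ∈ s, ∃ a ∈ R, ∃ b ∈ R, r * x = x * a + b) :
    IsNoetherianRing (Subring.closure (insert x s)) := by
  set T := Subring.closure (insert x s) with hT
  have hRT : R ≤ T := hs ▸ Subring.closure_mono (Set.subset_insert x s)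
  have hxT : x ∈ T := Subring.subset_closure (Set.mem_insert x s)
  have h₁' : ∀ r ∈ R, ∃ a ∈ R, ∃ b ∈ R, x * r = a * x + b := by
    intro r hr
    rw [hs] at hr
    induction hr using Subring.closure_induction with
    | mem r hr => exact h₁ r hr
    | zero => exact ⟨0, zero_mem _, 0, zero_mem _, by simp⟩
    | one => exact ⟨1, one_mem _, 0, zero_mem _, by simp⟩
    | add r t _ _ hr ht =>
      obtain ⟨a, ha, b, hb, h⟩ := hr
      obtain ⟨a', ha', b', hb', h'⟩ := ht
      exact ⟨a + a', add_mem ha ha', b + b', add_mem hb hb', by rw [mul_add, h, h']; noncomm_ring⟩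
    | neg r _ hr =>
      obtain ⟨a, ha, b, hb, h⟩ := hr
      exact ⟨-a, neg_mem ha, -b, neg_mem hb, by rw [mul_neg, h]; noncomm_ring⟩
    | mul r t _ ht' hr ht =>
      obtain ⟨a, ha, b, hb, h⟩ := hr
      obtain ⟨a', ha', b', hb', h'⟩ := ht
      refine ⟨a * a', mul_mem ha ha', a * b' + b * t,
        add_mem (mul_mem ha hb') (mul_mem hb (hs ▸ ht')), ?_⟩
      rw [← mul_assoc, h, add_mul, mul_assoc, h']
      noncomm_ring
  have h₂' : ∀ r ∈ R, ∃ a ∈ R, ∃ b ∈ R, r * x = x * a + b := by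
    intro r hr
    rw [hs] at hr
    induction hr using Subring.closure_induction with
    | mem r hr => exact h₂ r hr
    | zero => exact ⟨0, zero_mem _, 0, zero_mem _, by simp⟩
    | one => exact ⟨1, one_mem _, 0, zero_mem _, by simp⟩
    | add r t _ _ hr ht =>
      obtain ⟨a, ha, b, hb, h⟩ := hr
      obtain ⟨a', ha', b', hb', h'⟩ := ht
      exact ⟨a + a', add_mem ha ha', b + b', add_mem hb hb', by rw [add_mul, h, h']; noncomm_ring⟩
    | neg r _ hr =>
      obtain ⟨a, ha, b, hb, h⟩ := hr
      exact ⟨-a, neg_mem ha, -b, neg_mem hb, by rw [neg_mul, h]; noncomm_ring⟩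
    | mul r t hr' _ hr ht =>
      obtain ⟨a, ha, b, hb, h⟩ := hr
      obtain ⟨a', ha', b', hb', h'⟩ := ht
      refine ⟨a * a', mul_mem ha ha', b * a' + r * b',
        add_mem (mul_mem hb ha') (mul_mem (hs ▸ hr') hb'), ?_⟩
      rw [mul_assoc, h', mul_add, ← mul_assoc, h]
      noncomm_ring
  refine IsNoetherianRing.of_adjoin_normalizing (Subring.inclusion hRT) ⟨x, hxT⟩ ?_ ?_ ?_
  · rintro ⟨r, hr⟩
    obtain ⟨a, ha, b, hb, h⟩ := h₁' r hr
    exact ⟨⟨a, ha⟩, ⟨b, hb⟩, Subtype.ext h⟩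
  · rintro ⟨r, hr⟩
    obtain ⟨a, ha, b, hb, h⟩ := h₂' r hr
    exact ⟨⟨a, ha⟩, ⟨b, hb⟩, Subtype.ext h⟩
  · set G : Set T := insert ⟨x, hxT⟩ (Set.range (Subring.inclusion hRT))
    have hle : T ≤ (Subring.closure G).map T.subtype := by
      refine Subring.closure_le.mpr ?_
      rintro y (rfl | h)
      · exact ⟨⟨y, hxT⟩, Subring.subset_closure (Set.mem_insert _ _), rfl⟩
      · have hy : y ∈ R := hs ▸ Subring.subset_closure h
        exact ⟨⟨y, hRT hy⟩, Subring.subset_closure (Set.mem_insert_of_mem _ ⟨⟨y, hy⟩, rfl⟩), rfl⟩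
    refine eq_top_iff.mpr fun y _ => ?_
    obtain ⟨z, hz, hzy⟩ := hle y.2
    rwa [← Subtype.ext hzy]

/-! ### Pairs of elements satisfying the down-up relations -/

/-- The elements `d` and `u` of an `R`-algebra satisfy the relations of the down-up algebra
`A(α, β, γ)`. -/
structure IsDownUpPair {R S : Type*} [CommRing R] [Ring S] [Algebra R S] (α β γ : R) (d u : S) :
    Prop where
  ddu : d ^ 2 * u = α • (d * u * d) + β • (u * d ^ 2) + γ • d
  duu : d * u ^ 2 = α • (u * d * u) + β • (u ^ 2 * d) + γ • u

/-! ### The automorphism that moves d and u past polynomials in ud and du -/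

section Twist

variable {R : Type*} [CommRing R]

/-- The automorphism `X₀ ↦ X₁`, `X₁ ↦ α X₁ + β X₀ + γ` of the polynomial ring in two variables. -/
noncomputable def downUpTwist (α : R) (β : Rˣ) (γ : R) :
    MvPolynomial (Fin 2) R ≃ₐ[R] MvPolynomial (Fin 2) R :=
  AlgEquiv.ofAlgHom
    (MvPolynomial.aeval ![MvPolynomial.X 1,
      α • MvPolynomial.X 1 + (β : R) • MvPolynomial.X 0 + MvPolynomial.C γ])
    (MvPolynomial.aeval ![(↑β⁻¹ : R) • (MvPolynomial.X 1 - α • MvPolynomial.X 0 -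
      MvPolynomial.C γ), MvPolynomial.X 0])
    (by
      have hb : MvPolynomial.C (↑β⁻¹ : R) * MvPolynomial.C (β : R) =
          (1 : MvPolynomial (Fin 2) R) := by
        rw [← map_mul, Units.inv_mul, map_one]
      ext i : 1
      fin_cases i
      · simp only [MvPolynomial.smul_eq_C_mul, Fin.zero_eta, AlgHom.coe_comp, Function.comp_apply,
          MvPolynomial.aeval_X, map_mul, map_sub, Matrix.cons_val_zero, Matrix.cons_val_one,
          MvPolynomial.algHom_C, MvPolynomial.algebraMap_eq, AlgHom.id_apply]
        linear_combination MvPolynomial.X 0 * hb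
      · simp)
    (by
      ext i : 1
      fin_cases i
      · simp
      · simp only [Fin.mk_one, AlgHom.coe_comp, Function.comp_apply, MvPolynomial.aeval_X,
          map_add, map_smul, Matrix.cons_val_zero, Matrix.cons_val_one, smul_smul,
          Units.mul_inv, one_smul, MvPolynomial.algHom_C, MvPolynomial.algebraMap_eq,
          AlgHom.id_apply]
        ring)

variable (α : R) (β : Rˣ) (γ : R)

@[simp] lemma downUpTwist_X_zero :
    downUpTwist α β γ (MvPolynomial.X 0) = MvPolynomial.X 1 := by
  simp [downUpTwist]

@[simp] lemma downUpTwist_X_one :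
    downUpTwist α β γ (MvPolynomial.X 1) =
      α • MvPolynomial.X 1 + (β : R) • MvPolynomial.X 0 + MvPolynomial.C γ := by
  simp [downUpTwist]

@[simp] lemma downUpTwist_C (c : R) :
    downUpTwist α β γ (MvPolynomial.C c) = MvPolynomial.C c :=
  (downUpTwist α β γ).commutes c

end Twist

/-! ### Commutation rules and noetherianity -/

namespace IsDownUpPair

variable {R S : Type*} [CommRing R] [Ring S] [Algebra R S] {α β γ : R} {d u : S}

/-- Rewriting d²u inside u(d²u) and du² inside (du²)d gives the same expression α udud + β u²d² + γ
ud. -/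
lemma commute (h : IsDownUpPair α β γ d u) : Commute (u * d) (d * u) := by
  have h1 : u * d * (d * u) = u * (d ^ 2 * u) := by noncomm_ring
  have h2 : d * u * (u * d) = (d * u ^ 2) * d := by noncomm_ring
  rw [Commute, SemiconjBy, h1, h2, h.ddu, h.duu]
  simp only [mul_add, add_mul, mul_smul_comm, smul_mul_assoc]
  congr 2 <;> congr 1 <;> noncomm_ring

/-- The opposite algebra satisfies the down-up relations with `d` and `u` exchanged. -/
lemma op (h : IsDownUpPair α β γ d u) :
    IsDownUpPair α β γ (MulOpposite.op u) (MulOpposite.op d) where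
  ddu := by
    have := congrArg MulOpposite.op h.duu
    simpa [mul_assoc] using this
  duu := by
    have := congrArg MulOpposite.op h.ddu
    simpa [mul_assoc] using this

/-- Evaluation of polynomials needs a commutative target, so it is performed in the subalgebra
generated by the commuting elements ud and du. -/
lemma exists_polyHom (h : IsDownUpPair α β γ d u) : ∃ φ : MvPolynomial (Fin 2) R →ₐ[R] S,
    φ (MvPolynomial.X 0) = u * d ∧ φ (MvPolynomial.X 1) = d * u := by
  have hc : ∀ a ∈ ({u * d, d * u} : Set S), ∀ b ∈ ({u * d, d * u} : Set S), a * b = b * a := by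
    rintro a (rfl | rfl) b (rfl | rfl)
    · rfl
    · exact h.commute
    · exact h.commute.symm
    · rfl
  let E := Algebra.adjoin R ({u * d, d * u} : Set S)
  have := Algebra.isMulCommutative_adjoin R hc
  open scoped IsMulCommutative in
  let x : E := ⟨u * d, Algebra.subset_adjoin (Or.inl rfl)⟩
  let y : E := ⟨d * u, Algebra.subset_adjoin (Or.inr rfl)⟩
  refine ⟨E.val.comp (MvPolynomial.aeval ![x, y]), ?_, ?_⟩
  · simp [x]
  · simp [y]

/-- The homomorphism from the polynomial ring in two variables with `X₀ ↦ u d`, `X₁ ↦ d u`. -/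
noncomputable def polyHom (h : IsDownUpPair α β γ d u) : MvPolynomial (Fin 2) R →ₐ[R] S :=
  h.exists_polyHom.choose

@[simp] lemma polyHom_X_zero (h : IsDownUpPair α β γ d u) :
    h.polyHom (MvPolynomial.X 0) = u * d :=
  h.exists_polyHom.choose_spec.1

@[simp] lemma polyHom_X_one (h : IsDownUpPair α β γ d u) :
    h.polyHom (MvPolynomial.X 1) = d * u :=
  h.exists_polyHom.choose_spec.2

@[simp] lemma polyHom_C (h : IsDownUpPair α β γ d u) (c : R) :
    h.polyHom (MvPolynomial.C c) = algebraMap R S c :=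
  h.polyHom.commutes c

variable {b : Rˣ}

/-- On generators this is d(ud) = (du)d and the first relation, d(du) = (α du + β ud + γ)d. The
second relation plays the same role for `u` below. -/
lemma d_mul_polyHom (h : IsDownUpPair α b γ d u) (p : MvPolynomial (Fin 2) R) :
    d * h.polyHom p = h.polyHom (downUpTwist α b γ p) * d := by
  induction p using MvPolynomial.induction_on with
  | C c => simpa using (Algebra.commutes c d).symm
  | add p q hp hq => simp only [map_add, mul_add, add_mul, hp, hq]
  | mul_X p i hp =>
    rw [map_mul, ← mul_assoc, hp, map_mul, map_mul, mul_assoc, mul_assoc]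
    congr 1
    fin_cases i
    · simp [mul_assoc]
    · have h1 := h.ddu
      simp only [Fin.mk_one, polyHom_X_one, downUpTwist_X_one, map_add, map_smul,
        polyHom_X_zero, polyHom_C, add_mul, smul_mul_assoc, ← Algebra.smul_def]
      rw [← mul_assoc, ← pow_two, h1, pow_two, mul_assoc u d d]

lemma u_mul_polyHom (h : IsDownUpPair α b γ d u) (p : MvPolynomial (Fin 2) R) :
    u * h.polyHom (downUpTwist α b γ p) = h.polyHom p * u := by
  induction p using MvPolynomial.induction_on with
  | C c => simpa using (Algebra.commutes c u).symm
  | add p q hp hq => simp only [map_add, mul_add, add_mul, hp, hq]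
  | mul_X p i hp =>
    rw [map_mul, map_mul, ← mul_assoc, hp, map_mul, mul_assoc, mul_assoc]
    congr 1
    fin_cases i
    · simp [mul_assoc]
    · have h1 := h.duu
      simp only [Fin.mk_one, polyHom_X_one, downUpTwist_X_one, map_add, map_smul,
        polyHom_X_zero, polyHom_C, mul_add, mul_smul_comm]
      rw [mul_assoc d u u, ← pow_two, h1, ← Algebra.commutes, ← Algebra.smul_def, pow_two]
      simp only [mul_assoc]

lemma polyHom_mul_d (h : IsDownUpPair α b γ d u) (p : MvPolynomial (Fin 2) R) :
    h.polyHom p * d = d * h.polyHom ((downUpTwist α b γ).symm p) := by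
  rw [h.d_mul_polyHom, AlgEquiv.apply_symm_apply]

lemma u_mul_polyHom' (h : IsDownUpPair α b γ d u) (p : MvPolynomial (Fin 2) R) :
    u * h.polyHom p = h.polyHom ((downUpTwist α b γ).symm p) * u := by
  rw [← h.u_mul_polyHom, AlgEquiv.apply_symm_apply]

lemma isNoetherianRing [IsNoetherianRing R] (h : IsDownUpPair α b γ d u)
    (hgen : Algebra.adjoin R {d, u} = ⊤) : IsNoetherianRing S := by
  set R₀ : Subring S := h.polyHom.range.toSubring
  have hR₀ : R₀ = Subring.closure (R₀ : Set S) := (Subring.closure_eq R₀).symm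
  have hN₀ : IsNoetherianRing R₀ :=
    isNoetherianRing_of_surjective (MvPolynomial (Fin 2) R) R₀
      h.polyHom.rangeRestrict.toRingHom h.polyHom.rangeRestrict_surjective
  have hN₁ : IsNoetherianRing (Subring.closure (insert u (R₀ : Set S))) := by
    refine R₀.isNoetherianRing_closure_insert u _ hR₀ ?_ ?_
    · rintro _ ⟨p, rfl⟩
      exact ⟨_, ⟨_, rfl⟩, 0, zero_mem _, by simpa using h.u_mul_polyHom' p⟩
    · rintro _ ⟨p, rfl⟩
      exact ⟨_, ⟨_, rfl⟩, 0, zero_mem _, by simpa using (h.u_mul_polyHom p).symm⟩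
  have hle : (R₀ : Set S) ⊆ Subring.closure (insert u (R₀ : Set S)) :=
    (Set.subset_insert _ _).trans Subring.subset_closure
  have hN₂ : IsNoetherianRing (Subring.closure (insert d (insert u (R₀ : Set S)))) := by
    refine Subring.isNoetherianRing_closure_insert _ d _ rfl ?_ ?_
    · rintro _ (rfl | ⟨p, rfl⟩)
      -- Both du and ud already lie in the polynomial subring, so `d` normalizes `u` with
      -- coefficient `0` and the product as remainder.
      · exact ⟨0, zero_mem _, _, hle ⟨MvPolynomial.X 1, rfl⟩, by simp⟩
      · exact ⟨_, hle ⟨_, rfl⟩, 0, zero_mem _, by simpa using h.d_mul_polyHom p⟩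
    · rintro _ (rfl | ⟨p, rfl⟩)
      · exact ⟨0, zero_mem _, _, hle ⟨MvPolynomial.X 0, rfl⟩, by simp⟩
      · exact ⟨_, hle ⟨_, rfl⟩, 0, zero_mem _, by simpa using h.polyHom_mul_d p⟩
  have htop : Subring.closure (insert d (insert u (R₀ : Set S))) = ⊤ := by
    rw [eq_top_iff, ← Algebra.top_toSubring (R := R), ← hgen, Algebra.adjoin_eq_ring_closure]
    refine Subring.closure_mono ?_
    rintro _ (⟨c, rfl⟩ | rfl | rfl)
    · exact Or.inr (Or.inr ⟨MvPolynomial.C c, h.polyHom_C c⟩)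
    · exact Or.inl rfl
    · exact Or.inr (Or.inl rfl)
  rw [htop] at hN₂
  exact isNoetherianRing_of_ringEquiv _ Subring.topEquiv

/-- An algebra over a commutative noetherian ring that is generated by a down-up pair with `β`
invertible is noetherian. -/
theorem isLeftRightNoetherian [IsNoetherianRing R] (h : IsDownUpPair α b γ d u)
    (hgen : Algebra.adjoin R {d, u} = ⊤) : IsLeftRightNoetherian S := by
  refine ⟨h.isNoetherianRing hgen, h.op.isNoetherianRing ?_⟩
  have h1 : ({MulOpposite.op u, MulOpposite.op d} : Set Sᵐᵒᵖ) = MulOpposite.unop ⁻¹' {d, u} := by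
    ext z
    simp [or_comm, ← MulOpposite.unop_inj (x := z)]
  rw [h1, ← Subalgebra.op_adjoin, hgen]
  rfl

end IsDownUpPair

/-! ### Standard monomials -/

/-- The exponents `(k, m)` of the standard monomials `(u d) ^ m₀ (d u) ^ m₁ t_k`, where `t_k = d ^ k`
for `k ≥ 0` and `t_k = u ^ (-k)` for `k < 0`. -/
abbrev DownUpExp : Type := Σ _ : ℤ, Fin 2 →₀ ℕ

namespace DownUpExp

/-- The degree of a standard monomial. -/
noncomputable def deg (i : DownUpExp) : ℕ := 2 * i.2.degree + i.1.natAbs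

lemma finite_deg_le (n : ℕ) : {i : DownUpExp | i.deg ≤ n}.Finite := by
  have h1 : (Set.Icc (-(n : ℤ)) n).Finite := Set.finite_Icc _ _
  have h2 : {m : Fin 2 →₀ ℕ | m.degree ≤ n}.Finite := Finsupp.finite_of_degree_le n
  refine ((h1.prod h2).image fun p => (⟨p.1, p.2⟩ : DownUpExp)).subset ?_
  rintro ⟨k, m⟩ h
  simp only [deg, Set.mem_ofPred_eq] at h
  refine ⟨(k, m), ⟨⟨?_, ?_⟩, ?_⟩, rfl⟩
  · change -(n : ℤ) ≤ k
    omega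
  · change k ≤ (n : ℤ)
    omega
  · change m.degree ≤ n
    omega

section

variable {S : Type*} [Ring S] (d u : S)

/-- `d ^ k` for `k ≥ 0` and `u ^ (-k)` for `k < 0`. -/
def tpow : ℤ → S
  | .ofNat n => d ^ n
  | .negSucc n => u ^ (n + 1)

/-- The standard monomial `(u d) ^ m₀ (d u) ^ m₁ t_k`. -/
def monom (i : DownUpExp) : S := (u * d) ^ i.2 0 * (d * u) ^ i.2 1 * tpow d u i.1

lemma tpow_natCast (n : ℕ) : tpow d u n = d ^ n := rfl

lemma tpow_neg_natCast (n : ℕ) : tpow d u (-n) = u ^ n := by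
  cases n with
  | zero => simp [tpow]
  | succ n => rfl

end

end DownUpExp

/-! ### Spanning by standard monomials, with control of degrees -/

namespace IsDownUpPair

open DownUpExp MvPolynomial

variable {R S : Type*} [CommRing R] [Ring S] [Algebra R S] {α β γ : R} {b : Rˣ} {d u : S}

lemma polyHom_monomial (h : IsDownUpPair α β γ d u) (m : Fin 2 →₀ ℕ) (c : R) :
    h.polyHom (monomial m c) = c • ((u * d) ^ m 0 * (d * u) ^ m 1) := by
  rw [monomial_eq, map_mul, polyHom_C, ← Algebra.smul_def]
  simp [Finsupp.prod_fintype, Fin.prod_univ_two]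

lemma monom_eq (h : IsDownUpPair α β γ d u) (i : DownUpExp) :
    monom d u i = h.polyHom (monomial i.2 1) * tpow d u i.1 := by
  rw [h.polyHom_monomial, one_smul, monom]

lemma polyHom_mul_tpow_mem (h : IsDownUpPair α β γ d u) (p : MvPolynomial (Fin 2) R) {k : ℤ}
    {n : ℕ} (hn : 2 * p.totalDegree + k.natAbs ≤ n) :
    h.polyHom p * tpow d u k ∈ Submodule.span R (monom d u '' {i | i.deg ≤ n}) := by
  have h1 : p = ∑ m ∈ p.support, p.coeff m • monomial m (1 : R) := by
    conv_lhs => rw [p.as_sum]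
    simp [smul_monomial]
  rw [h1, map_sum, Finset.sum_mul]
  refine sum_mem fun m hm => ?_
  rw [map_smul, smul_mul_assoc]
  refine Submodule.smul_mem _ _ (Submodule.subset_span ⟨⟨k, m⟩, ?_, h.monom_eq _⟩)
  have := le_totalDegree hm
  change 2 * m.degree + k.natAbs ≤ n
  rw [Finsupp.degree_eq_sum]
  rw [Finsupp.sum_fintype _ _ (fun _ => rfl)] at this
  omega

/-- The twist sends each variable to a polynomial of degree at most one, so passing `d` across a
polynomial costs no degree. -/
lemma totalDegree_downUpTwist_monomial (m : Fin 2 →₀ ℕ) :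
    (downUpTwist α b γ (monomial m 1)).totalDegree ≤ m.degree := by
  have h1 : (downUpTwist α b γ (X 1)).totalDegree ≤ 1 := by
    rw [downUpTwist_X_one]
    have hX : ∀ i : Fin 2, (X i : MvPolynomial (Fin 2) R).totalDegree ≤ 1 := fun i =>
      (totalDegree_monomial_le _ _).trans (by simp)
    refine (totalDegree_add _ _).trans (max_le ((totalDegree_add _ _).trans (max_le ?_ ?_)) ?_)
    · exact (totalDegree_smul_le _ _).trans (hX 1)
    · exact (totalDegree_smul_le _ _).trans (hX 0)
    · simp
  have h0 : (downUpTwist α b γ (X 0)).totalDegree ≤ 1 := by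
    rw [downUpTwist_X_zero]
    exact (totalDegree_monomial_le _ _).trans (by simp)
  rw [monomial_eq, Finsupp.prod_fintype _ _ (by simp), Fin.prod_univ_two, map_one, one_mul,
    map_mul, map_pow, map_pow, Finsupp.degree_eq_sum, Fin.sum_univ_two]
  refine (totalDegree_mul _ _).trans (add_le_add ?_ ?_)
  · exact (totalDegree_pow _ _).trans (by nlinarith)
  · exact (totalDegree_pow _ _).trans (by nlinarith)

lemma totalDegree_downUpTwist_symm_monomial (m : Fin 2 →₀ ℕ) :
    ((downUpTwist α b γ).symm (monomial m 1)).totalDegree ≤ m.degree := by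
  have hX : ∀ i : Fin 2, (X i : MvPolynomial (Fin 2) R).totalDegree ≤ 1 := fun i =>
    (totalDegree_monomial_le _ _).trans (by simp)
  have h0 : ((downUpTwist α b γ).symm (X 0)).totalDegree ≤ 1 := by
    simp only [downUpTwist, AlgEquiv.ofAlgHom_symm, AlgEquiv.ofAlgHom_apply, aeval_X,
      Matrix.cons_val_zero]
    refine (totalDegree_smul_le _ _).trans ((totalDegree_sub _ _).trans
      (max_le ((totalDegree_sub _ _).trans (max_le (hX 1) ?_)) (by simp)))
    exact (totalDegree_smul_le _ _).trans (hX 0)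
  have h1 : ((downUpTwist α b γ).symm (X 1)).totalDegree ≤ 1 := by
    simpa [downUpTwist] using hX 0
  rw [monomial_eq, Finsupp.prod_fintype _ _ (by simp), Fin.prod_univ_two, map_one, one_mul,
    map_mul, map_pow, map_pow, Finsupp.degree_eq_sum, Fin.sum_univ_two]
  refine (totalDegree_mul _ _).trans (add_le_add ?_ ?_)
  · exact (totalDegree_pow _ _).trans (by nlinarith)
  · exact (totalDegree_pow _ _).trans (by nlinarith)

lemma totalDegree_mul_X_le (p : MvPolynomial (Fin 2) R) (i : Fin 2) :
    (p * X i).totalDegree ≤ p.totalDegree + 1 :=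
  (totalDegree_mul _ _).trans
    (Nat.add_le_add_left ((totalDegree_monomial_le _ _).trans (by simp)) _)

/-- If k ≥ 0, then d t_k = t_{k+1}. If k < 0, then d absorbs one u into the factor du: the
polynomial part gains weight 2 while |k| drops by one. Either way the degree bound rises by one. -/
lemma d_mul_monom_mem (h : IsDownUpPair α b γ d u) {n : ℕ} {i : DownUpExp} (hi : i.deg ≤ n) :
    d * monom d u i ∈ Submodule.span R (monom d u '' {i | i.deg ≤ n + 1}) := by
  obtain ⟨k, m⟩ := i
  have hm := totalDegree_downUpTwist_monomial (α := α) (b := b) (γ := γ) m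
  simp only [deg] at hi
  rw [h.monom_eq, ← mul_assoc, h.d_mul_polyHom, mul_assoc]
  cases k with
  | ofNat k =>
    have h1 : d * tpow d u (Int.ofNat k) = tpow d u ((k + 1 : ℕ) : ℤ) := (pow_succ' d k).symm
    rw [h1]
    refine h.polyHom_mul_tpow_mem _ ?_
    simp only [Int.ofNat_eq_natCast, Int.natAbs_natCast] at hi ⊢
    omega
  | negSucc k =>
    have h1 : d * tpow d u (Int.negSucc k) = h.polyHom (X 1) * tpow d u (-k) := by
      rw [tpow_neg_natCast, polyHom_X_one, mul_assoc, ← pow_succ']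
      rfl
    rw [h1, ← mul_assoc, ← map_mul]
    refine h.polyHom_mul_tpow_mem _ ?_
    have := totalDegree_mul_X_le (downUpTwist α b γ (monomial m 1)) 1
    simp only [Int.natAbs_negSucc, Int.natAbs_neg, Int.natAbs_natCast] at hi ⊢
    omega

lemma u_mul_monom_mem (h : IsDownUpPair α b γ d u) {n : ℕ} {i : DownUpExp} (hi : i.deg ≤ n) :
    u * monom d u i ∈ Submodule.span R (monom d u '' {i | i.deg ≤ n + 1}) := by
  obtain ⟨k, m⟩ := i
  have hm := totalDegree_downUpTwist_symm_monomial (α := α) (b := b) (γ := γ) m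
  simp only [deg] at hi
  rw [h.monom_eq, ← mul_assoc, h.u_mul_polyHom', mul_assoc]
  cases k with
  | negSucc k =>
    have h1 : u * tpow d u (Int.negSucc k) = tpow d u (-(k + 2 : ℕ)) := by
      rw [tpow_neg_natCast]
      exact (pow_succ' u (k + 1)).symm
    rw [h1]
    refine h.polyHom_mul_tpow_mem _ ?_
    simp only [Int.natAbs_negSucc, Int.natAbs_neg, Int.natAbs_natCast] at hi ⊢
    omega
  | ofNat k =>
    cases k with
    | zero =>
      have h1 : u * tpow d u (Int.ofNat 0) = tpow d u (-(1 : ℕ)) := by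
        rw [tpow_neg_natCast]
        simp [tpow]
      rw [h1]
      refine h.polyHom_mul_tpow_mem _ ?_
      simp only [Int.natAbs_neg, Int.natAbs_natCast] at hi ⊢
      omega
    | succ k =>
      have h1 : u * tpow d u (Int.ofNat (k + 1)) = h.polyHom (X 0) * tpow d u (k : ℤ) := by
        rw [tpow_natCast, polyHom_X_zero, mul_assoc, ← pow_succ']
        rfl
      rw [h1, ← mul_assoc, ← map_mul]
      refine h.polyHom_mul_tpow_mem _ ?_
      have := totalDegree_mul_X_le ((downUpTwist α b γ).symm (monomial m 1)) 0
      simp only [Int.ofNat_eq_natCast, Int.natAbs_natCast] at hi ⊢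
      omega

lemma monom_mem_pow {i : DownUpExp} {n : ℕ} (hi : i.deg ≤ n) :
    monom d u i ∈ Submodule.span R (insert 1 {d, u}) ^ n := by
  set E := Submodule.span R (insert (1 : S) {d, u})
  have h1 : 1 ≤ E := Submodule.one_le.mpr (Submodule.subset_span (Set.mem_insert _ _))
  refine pow_le_pow_right₀ h1 hi ?_
  have hd : d ∈ E := Submodule.subset_span (Or.inr (Or.inl rfl))
  have hu : u ∈ E := Submodule.subset_span (Or.inr (Or.inr rfl))
  have hx : u * d ∈ E ^ 2 := by
    rw [pow_two]
    exact Submodule.mul_mem_mul hu hd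
  have hy : d * u ∈ E ^ 2 := by
    rw [pow_two]
    exact Submodule.mul_mem_mul hd hu
  have ht : tpow d u i.1 ∈ E ^ i.1.natAbs := by
    cases i.1 with
    | ofNat k => exact Submodule.pow_mem_pow _ hd k
    | negSucc k => exact Submodule.pow_mem_pow _ hu (k + 1)
  have hdeg : i.deg = 2 * i.2 0 + 2 * i.2 1 + i.1.natAbs := by
    rw [deg, Finsupp.degree_eq_sum, Fin.sum_univ_two, mul_add]
  rw [hdeg, pow_add, pow_add, pow_mul, pow_mul]
  exact Submodule.mul_mem_mul (Submodule.mul_mem_mul (Submodule.pow_mem_pow _ hx _)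
    (Submodule.pow_mem_pow _ hy _)) ht

/-- The products of at most `n` of the elements `d`, `u` and the standard monomials of degree at
most `n` have the same span. -/
theorem span_pow_eq (h : IsDownUpPair α b γ d u) (n : ℕ) :
    Submodule.span R (insert 1 {d, u}) ^ n = Submodule.span R (monom d u '' {i | i.deg ≤ n}) := by
  refine le_antisymm ?_ (Submodule.span_le.mpr ?_)
  · induction n with
    | zero =>
      rw [pow_zero, Submodule.one_le]
      refine Submodule.subset_span ⟨⟨0, 0⟩, ?_, ?_⟩
      · simp [deg]
      · have h0 : tpow d u 0 = 1 := pow_zero d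
        simp [monom, h0]
    | succ n ih =>
      rw [pow_succ']
      refine (mul_le_mul' le_rfl ih).trans ?_
      rw [Submodule.span_mul_span, Submodule.span_le]
      rintro _ ⟨e, he, _, ⟨i, hi, rfl⟩, rfl⟩
      rcases he with rfl | rfl | rfl
      · exact Submodule.subset_span ⟨i, Nat.le_succ_of_le hi, (one_mul _).symm⟩
      · exact h.d_mul_monom_mem hi
      · exact h.u_mul_monom_mem hi
  · rintro _ ⟨i, hi, rfl⟩
    exact monom_mem_pow hi

theorem span_monom_eq_adjoin (h : IsDownUpPair α b γ d u) :
    Submodule.span R (Set.range (monom d u)) =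
      Subalgebra.toSubmodule (Algebra.adjoin R {d, u}) := by
  set T := Algebra.adjoin R ({d, u} : Set S)
  have hd : d ∈ T := Algebra.subset_adjoin (Or.inl rfl)
  have hu : u ∈ T := Algebra.subset_adjoin (Or.inr rfl)
  refine le_antisymm (Submodule.span_le.mpr ?_) fun a ha => ?_
  · rintro _ ⟨i, rfl⟩
    change _ ∈ T
    refine mul_mem (mul_mem (pow_mem (mul_mem hu hd) _) (pow_mem (mul_mem hd hu) _)) ?_
    cases i.1 with
    | ofNat k => exact pow_mem hd k
    | negSucc k => exact pow_mem hu (k + 1)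
  · have hmem : ∃ n, a ∈ Submodule.span R (insert (1 : S) {d, u}) ^ n := by
      have hle : (1 : Submodule R S) ≤ Submodule.span R (insert (1 : S) {d, u}) :=
        Submodule.one_le.mpr (Submodule.subset_span (Set.mem_insert _ _))
      replace ha : a ∈ T := ha
      induction ha using Algebra.adjoin_induction with
      | mem x hx => exact ⟨1, by rw [pow_one]; exact Submodule.subset_span (Or.inr hx)⟩
      | algebraMap r => exact ⟨0, by rw [pow_zero]; exact Submodule.algebraMap_mem r⟩
      | add x y _ _ hx hy =>
        obtain ⟨m, hm⟩ := hx
        obtain ⟨n, hn⟩ := hy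
        exact ⟨max m n, add_mem (pow_le_pow_right₀ hle (le_max_left m n) hm)
          (pow_le_pow_right₀ hle (le_max_right m n) hn)⟩
      | mul x y _ _ hx hy =>
        obtain ⟨m, hm⟩ := hx
        obtain ⟨n, hn⟩ := hy
        exact ⟨m + n, by rw [pow_add]; exact Submodule.mul_mem_mul hm hn⟩
    obtain ⟨n, hn⟩ := hmem
    rw [h.span_pow_eq] at hn
    exact Submodule.span_mono (Set.image_subset_range _ _) hn

end IsDownUpPair

/-! ### Polynomial identities -/

/-- An algebra that is finite over a commutative ring satisfies a polynomial identity. -/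
theorem IsPIAlgebra.of_finite {K S : Type*} [CommRing K] [Nontrivial K] [Ring S] [Algebra K S]
    (Z : Type*) [CommRing Z] [Algebra Z S] [Module.Finite Z S] : IsPIAlgebra K S := by
  classical
  obtain ⟨n, g, hg⟩ := Module.Finite.exists_fin (R := Z) (M := S)
  -- The identity is the standard polynomial in one more variable than there are module generators.
  let m := n + 1
  refine ⟨∑ π : Equiv.Perm (Fin m), (Equiv.Perm.sign π : ℤ) •
    (List.ofFn fun i => FreeAlgebra.ι K ((π i : Fin m) : ℕ)).prod, ?_, fun x => ?_⟩
  · intro h0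
    -- Nonvanishing is read off at the word 0, 1, …, m − 1, to which only the identity permutation
    -- contributes, with coefficient 1.
    have h1 := congrArg (fun q => (FreeAlgebra.equivMonoidAlgebraFreeMonoid q).coeff
      (FreeMonoid.ofList (List.ofFn fun i : Fin m => (i : ℕ)))) h0
    have hword : ∀ π : Equiv.Perm (Fin m), FreeAlgebra.equivMonoidAlgebraFreeMonoid
        (List.ofFn fun i => FreeAlgebra.ι K ((π i : Fin m) : ℕ)).prod =
        MonoidAlgebra.single
          (FreeMonoid.ofList (List.ofFn fun i => ((π i : Fin m) : ℕ))) (1 : K) := by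
      intro π
      rw [map_list_prod, List.map_ofFn]
      have hlist : ∀ l : List ℕ, FreeMonoid.ofList l = (l.map FreeMonoid.of).prod := by
        intro l
        induction l with
        | nil => rfl
        | cons a l ih => rw [List.map_cons, List.prod_cons, ← ih, FreeMonoid.ofList_cons]
      have h2 : (FreeMonoid.ofList (List.ofFn fun i => ((π i : Fin m) : ℕ))) =
          (List.ofFn fun i => FreeMonoid.of ((π i : Fin m) : ℕ)).prod := by
        rw [hlist, List.map_ofFn]
        rfl
      rw [h2, ← MonoidAlgebra.of_apply, map_list_prod, List.map_ofFn]
      congr 2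
      funext i
      simp [FreeAlgebra.equivMonoidAlgebraFreeMonoid]
    have hinj : ∀ π : Equiv.Perm (Fin m),
        (FreeMonoid.ofList (List.ofFn fun i => ((π i : Fin m) : ℕ)) =
          FreeMonoid.ofList (List.ofFn fun i : Fin m => (i : ℕ))) ↔ π = 1 := by
      intro π
      rw [FreeMonoid.ofList.injective.eq_iff, List.ofFn_inj, funext_iff, Equiv.ext_iff]
      simp [Fin.ext_iff]
    simp only [map_sum, map_zsmul, hword, map_zero, MonoidAlgebra.coeff_sum,
      Finsupp.finsetSum_apply] at h1
    rw [Finset.sum_eq_single (1 : Equiv.Perm (Fin m))] at h1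
    · simp at h1
    · intro π _ hπ
      have := (hinj π).not.mpr hπ
      simp [Finsupp.single_eq_of_ne' this, -List.ofFn_succ]
    · simp
  -- The standard polynomial is an alternating `Z`-multilinear form. Pulled back to the free module
  -- of rank `n` it vanishes, since no `n + 1` basis vectors are distinct; surjectivity of `p`
  -- carries this to `S`.
  · let A : S [⋀^Fin m]→ₗ[Z] S :=
      MultilinearMap.alternatization (MultilinearMap.mkPiAlgebraFin Z m S)
    let p : (Fin n → Z) →ₗ[Z] S :=
      Fintype.linearCombination _ g
    have hp : Function.Surjective p := by
      rw [← LinearMap.range_eq_top, Fintype.range_linearCombination, hg]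
    have hA : A.compLinearMap p = 0 := by
      refine Module.Basis.ext_alternating (Pi.basisFun _ (Fin n)) fun v hv => ?_
      have := Fintype.card_le_of_injective v hv
      simp [m] at this
    choose y hy using fun i : Fin m => hp (x i)
    have h0 : A (fun i => x i) = 0 := by
      have := DFunLike.congr_fun hA y
      simpa [AlternatingMap.compLinearMap_apply, hy] using this
    rw [MultilinearMap.alternatization_apply] at h0
    rw [← h0, map_sum]
    refine Finset.sum_congr rfl fun π _ => ?_
    rw [map_zsmul, map_list_prod, List.map_ofFn]
    simp [Function.comp_def, Units.smul_def, -List.ofFn_succ]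

/-! ### Down-up pairs over a finite ring -/

section FiniteTwist

open MvPolynomial

variable {R : Type*} [CommRing R] (α : R) (b : Rˣ) (γ : R)

/-- The twist preserves the polynomials of degree at most one, a finite set over a finite ring.
Hence two of its powers agree on both variables and so are equal. -/
lemma exists_downUpTwist_pow_eq_one [Finite R] : ∃ N, 0 < N ∧ downUpTwist α b γ ^ N = 1 := by
  let W : R × R × R → MvPolynomial (Fin 2) R := fun v => v.1 • X 0 + v.2.1 • X 1 + C v.2.2
  have hW : ∀ (n : ℕ) (p : MvPolynomial (Fin 2) R), p ∈ Set.range W →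
      (downUpTwist α b γ ^ n) p ∈ Set.range W := by
    intro n
    induction n with
    | zero => exact fun p hp => by simpa using hp
    | succ n ih =>
      rintro _ ⟨v, rfl⟩
      rw [pow_succ, AlgEquiv.mul_apply]
      refine ih _ ⟨(v.2.1 * b, v.1 + v.2.1 * α, v.2.2 + v.2.1 * γ), ?_⟩
      simp only [W, map_add, downUpTwist_X_zero, downUpTwist_X_one, downUpTwist_C,
        smul_eq_C_mul, map_mul]
      ring
  have h0 : X 0 ∈ Set.range W := ⟨(1, 0, 0), by simp [W]⟩
  have h1 : X 1 ∈ Set.range W := ⟨(0, 1, 0), by simp [W]⟩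
  let F : ℕ → Set.range W × Set.range W := fun n =>
    (⟨_, hW n _ h0⟩, ⟨_, hW n _ h1⟩)
  have : Finite (Set.range W) := Set.finite_range W
  obtain ⟨i, j, hij, hF⟩ := Finite.exists_ne_map_eq_of_infinite F
  wlog hlt : i < j generalizing i j
  · exact this j i hij.symm hF.symm (lt_of_le_of_ne (not_lt.mp hlt) hij.symm)
  have hpow : downUpTwist α b γ ^ i = downUpTwist α b γ ^ j := by
    refine AlgEquiv.coe_toAlgHom_injective (MvPolynomial.algHom_ext fun k => ?_)
    fin_cases k
    · exact congrArg (fun q => (q.1 : MvPolynomial (Fin 2) R)) hF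
    · exact congrArg (fun q => (q.2 : MvPolynomial (Fin 2) R)) hF
  refine ⟨j - i, by omega, ?_⟩
  have h2 : downUpTwist α b γ ^ i * downUpTwist α b γ ^ (j - i) = downUpTwist α b γ ^ i := by
    rw [← pow_add, Nat.add_sub_cancel' hlt.le, hpow]
  exact mul_eq_left.mp h2

variable {α b γ}

/-- An element of a commutative ring is integral over the elements fixed by an automorphism of
finite order. -/
lemma isIntegralElem_subtype_eqLocus {P : Type*} [CommRing P] [Algebra R P] (σ : P ≃ₐ[R] P)
    {N : ℕ} (hσ : σ ^ N = 1)
    (hN : 0 < N) (p : P) : ((σ : P →+* P).eqLocus (RingHom.id P)).subtype.IsIntegralElem p := by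
  -- Since σᴺ = 1, applying σ permutes the factors cyclically, so the coefficients of this monic
  -- polynomial are σ-fixed.
  let f : Polynomial P := ∏ i ∈ Finset.range N, (Polynomial.X - Polynomial.C ((σ ^ i) p))
  have hf : f.Monic := Polynomial.monic_prod_of_monic _ _ fun i _ => Polynomial.monic_X_sub_C _
  have hfσ : f.map (σ : P →+* P) = f := by
    have h1 : ∀ i, (Polynomial.X - Polynomial.C ((σ ^ i) p)).map (σ : P →+* P) =
        Polynomial.X - Polynomial.C ((σ ^ (i + 1)) p) := by
      intro i
      simp [pow_succ', AlgEquiv.mul_apply]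
    obtain ⟨M, rfl⟩ : ∃ M, N = M + 1 := ⟨N - 1, by omega⟩
    simp only [f, Polynomial.map_prod, h1]
    rw [Finset.prod_range_succ, Finset.prod_range_succ', hσ]
    simp
  have hf0 : f.eval p = 0 := by
    rw [Polynomial.eval_prod]
    exact Finset.prod_eq_zero (Finset.mem_range.mpr hN) (by simp)
  have hlift : f ∈ Polynomial.lifts ((σ : P →+* P).eqLocus (RingHom.id P)).subtype := by
    rw [Polynomial.lifts_iff_coeff_lifts]
    intro n
    refine ⟨⟨f.coeff n, ?_⟩, rfl⟩
    change σ (f.coeff n) = f.coeff n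
    conv_rhs => rw [← hfσ, Polynomial.coeff_map]
    rfl
  obtain ⟨q, hq, -, hqm⟩ := Polynomial.lifts_and_natDegree_eq_and_monic hlift hf
  refine ⟨q, hqm, ?_⟩
  rw [← Polynomial.eval_map, hq, hf0]

end FiniteTwist

/-! ### Central elements and finiteness over the centre -/

namespace IsDownUpPair

open MvPolynomial DownUpExp

variable {R S : Type*} [CommRing R] [Ring S] [Algebra R S] {α γ : R} {b : Rˣ} {d u : S}

lemma d_pow_mul_polyHom (h : IsDownUpPair α b γ d u) (n : ℕ) (p : MvPolynomial (Fin 2) R) :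
    d ^ n * h.polyHom p = h.polyHom ((downUpTwist α b γ ^ n) p) * d ^ n := by
  induction n generalizing p with
  | zero => simp
  | succ n ih =>
    rw [pow_succ, mul_assoc, h.d_mul_polyHom, ← mul_assoc, ih, pow_succ (downUpTwist α b γ),
      AlgEquiv.mul_apply, mul_assoc]

lemma u_pow_mul_polyHom (h : IsDownUpPair α b γ d u) (n : ℕ) (p : MvPolynomial (Fin 2) R) :
    u ^ n * h.polyHom ((downUpTwist α b γ ^ n) p) = h.polyHom p * u ^ n := by
  induction n generalizing p with
  | zero => simp
  | succ n ih =>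
    rw [pow_succ, mul_assoc, pow_succ', AlgEquiv.mul_apply, h.u_mul_polyHom, ← mul_assoc, ih,
      mul_assoc]

lemma mem_center (hgen : Algebra.adjoin R {d, u} = ⊤) {z : S} (hd : Commute z d)
    (hu : Commute z u) : z ∈ Subring.center S := by
  rw [Subring.mem_center_iff]
  intro a
  have ha : a ∈ Algebra.adjoin R {d, u} := by
    rw [hgen]
    trivial
  have hle : Algebra.adjoin R {d, u} ≤ Subalgebra.centralizer R {z} := by
    refine Algebra.adjoin_le ?_
    rintro _ (rfl | rfl)
    · exact (Subalgebra.mem_centralizer_iff R).mpr fun y hy => by rw [hy]; exact hd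
    · exact (Subalgebra.mem_centralizer_iff R).mpr fun y hy => by rw [hy]; exact hu
  exact ((Subalgebra.mem_centralizer_iff R).mp (hle ha) z rfl).symm

/-- Only commutation with u is at stake: as du = σ(ud) in polynomial terms, dᴺu = dᴺ⁻¹σ(x) =
σᴺ(x)dᴺ⁻¹ = x dᴺ⁻¹ = u dᴺ. -/
lemma d_pow_mem_center (h : IsDownUpPair α b γ d u) (hgen : Algebra.adjoin R {d, u} = ⊤) {N : ℕ}
    (hN : 0 < N) (hσ : downUpTwist α b γ ^ N = 1) : d ^ N ∈ Subring.center S := by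
  refine mem_center hgen (Commute.pow_self d N) ?_
  obtain ⟨M, rfl⟩ : ∃ M, N = M + 1 := ⟨N - 1, by omega⟩
  calc d ^ (M + 1) * u = d ^ M * h.polyHom (downUpTwist α b γ (X 0)) := by
        rw [downUpTwist_X_zero, polyHom_X_one, pow_succ, mul_assoc]
    _ = h.polyHom (X 0) * d ^ M := by
        rw [h.d_pow_mul_polyHom, ← AlgEquiv.mul_apply, ← pow_succ, hσ, AlgEquiv.one_apply]
    _ = u * d ^ (M + 1) := by rw [polyHom_X_zero, mul_assoc, ← pow_succ']

lemma u_pow_mem_center (h : IsDownUpPair α b γ d u) (hgen : Algebra.adjoin R {d, u} = ⊤) {N : ℕ}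
    (hN : 0 < N) (hσ : downUpTwist α b γ ^ N = 1) : u ^ N ∈ Subring.center S := by
  refine mem_center hgen ?_ (Commute.pow_self u N)
  obtain ⟨M, rfl⟩ : ∃ M, N = M + 1 := ⟨N - 1, by omega⟩
  calc u ^ (M + 1) * d
        = u ^ M * h.polyHom ((downUpTwist α b γ ^ M) (downUpTwist α b γ (X 0))) := by
        rw [← AlgEquiv.mul_apply, ← pow_succ, hσ, AlgEquiv.one_apply, polyHom_X_zero, pow_succ,
          mul_assoc]
    _ = d * u ^ (M + 1) := by
        rw [h.u_pow_mul_polyHom, downUpTwist_X_zero, polyHom_X_one, mul_assoc, ← pow_succ']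

lemma polyHom_mem_center (h : IsDownUpPair α b γ d u) (hgen : Algebra.adjoin R {d, u} = ⊤)
    {p : MvPolynomial (Fin 2) R} (hp : downUpTwist α b γ p = p) :
    h.polyHom p ∈ Subring.center S := by
  refine mem_center hgen ?_ ?_
  · have := h.d_mul_polyHom p
    rw [hp] at this
    exact this.symm
  · have := h.u_mul_polyHom p
    rw [hp] at this
    exact this.symm

/-- An algebra over a finite commutative ring generated by a down-up pair with `β` invertible
satisfies a polynomial identity. -/
theorem isPIAlgebra [Finite R] [Nontrivial R] (h : IsDownUpPair α b γ d u)
    (hgen : Algebra.adjoin R {d, u} = ⊤) : IsPIAlgebra R S := by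
  obtain ⟨N, hN, hσ⟩ := exists_downUpTwist_pow_eq_one α b γ
  let Z := Subring.center S
  let _ : Algebra Z S := Z.subtype.toAlgebra' fun c x => (Subring.mem_center_iff.mp c.2 x).symm
  have hpow : ∀ a : S, a ^ N ∈ Z → IsIntegral Z a := fun a ha =>
    ⟨Polynomial.X ^ N - Polynomial.C ⟨a ^ N, ha⟩, Polynomial.monic_X_pow_sub_C _ hN.ne', by
      rw [Polynomial.eval₂_sub, Polynomial.eval₂_X_pow, Polynomial.eval₂_C]
      exact sub_self _⟩
  have hpoly : ∀ p, IsIntegral Z (h.polyHom p) := by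
    intro p
    obtain ⟨q, hqm, hq⟩ := isIntegralElem_subtype_eqLocus (downUpTwist α b γ) hσ hN p
    -- σ-invariant polynomials have central image, so an integral equation over the invariants
    -- becomes one over the centre.
    let ψ : (downUpTwist α b γ : MvPolynomial (Fin 2) R →+* _).eqLocus (RingHom.id _) →+* Z :=
      (h.polyHom.toRingHom.comp (Subring.subtype _)).codRestrict Z fun c =>
        h.polyHom_mem_center hgen c.2
    refine ⟨q.map ψ, hqm.map ψ, ?_⟩
    rw [Polynomial.eval₂_map]
    have := congrArg h.polyHom.toRingHom hq
    rw [Polynomial.hom_eval₂, map_zero] at this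
    exact this
  have hx : IsIntegral Z (u * d) := by simpa using hpoly (X 0)
  have hy : IsIntegral Z (d * u) := by simpa using hpoly (X 1)
  have hd := hpow d (h.d_pow_mem_center hgen hN hσ)
  have hu := hpow u (h.u_pow_mem_center hgen hN hσ)
  let A : S → Submodule Z S := fun a => Subalgebra.toSubmodule (Algebra.adjoin Z {a})
  have hA : ∀ a k, a ^ k ∈ A a := fun a k =>
    pow_mem (Algebra.subset_adjoin (Set.mem_singleton a)) k
  -- Shaped like a standard monomial: a power of ud, a power of du, then a power of d or of u. Each
  -- factor is finitely generated by integrality.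
  let M : Submodule Z S := A (u * d) * A (d * u) * (A d ⊔ A u)
  have hM : M.FG := (hx.fg_adjoin_singleton.mul hy.fg_adjoin_singleton).mul
    (hd.fg_adjoin_singleton.sup hu.fg_adjoin_singleton)
  have htop : M = ⊤ := by
    refine eq_top_iff.mpr fun a _ => ?_
    have ha : a ∈ Submodule.span R (Set.range (monom d u)) := by
      rw [h.span_monom_eq_adjoin, hgen]
      trivial
    induction ha using Submodule.span_induction with
    | mem a ha =>
      obtain ⟨i, rfl⟩ := ha
      refine Submodule.mul_mem_mul (Submodule.mul_mem_mul (hA _ _) (hA _ _)) ?_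
      cases i.1 with
      | ofNat k => exact Submodule.mem_sup_left (hA d k)
      | negSucc k => exact Submodule.mem_sup_right (hA u (k + 1))
    | zero => exact zero_mem M
    | add a a' _ _ ha ha' => exact add_mem (ha trivial) (ha' trivial)
    | smul c a _ ha =>
      have hc : algebraMap R S c ∈ Z := Subring.mem_center_iff.mpr fun g =>
        (Algebra.commutes c g).symm
      rw [Algebra.smul_def]
      exact M.smul_mem (⟨algebraMap R S c, hc⟩ : Z) (ha trivial)
  have : Module.Finite Z S := ⟨htop ▸ hM⟩
  exact IsPIAlgebra.of_finite Z

end IsDownUpPair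

/-! ### Linear independence of the standard monomials -/

namespace DownUpAlgebra

open MvPolynomial DownUpExp

lemma isDownUpPair {R : Type*} [CommRing R] (α β γ : R) :
    IsDownUpPair α β γ (d α β γ) (u α β γ) where
  ddu := by simpa [d, u] using RingQuot.mkAlgHom_rel R (DownUpRel.ddu (α := α) (β := β) (γ := γ))
  duu := by simpa [d, u] using RingQuot.mkAlgHom_rel R (DownUpRel.duu (α := α) (β := β) (γ := γ))

/-- The algebra homomorphism from a down-up algebra attached to a down-up pair. -/
noncomputable def lift {R S : Type*} [CommRing R] [Ring S] [Algebra R S] {α β γ : R} {d' u' : S}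
    (h : IsDownUpPair α β γ d' u') : DownUpAlgebra α β γ →ₐ[R] S :=
  RingQuot.liftAlgHom R ⟨FreeAlgebra.lift R fun g => DownUpGen.casesOn g d' u', by
    intro x y hxy
    cases hxy with
    | ddu => simpa using h.ddu
    | duu => simpa using h.duu⟩

section Lift

variable {R S : Type*} [CommRing R] [Ring S] [Algebra R S] {α β γ : R} {d' u' : S}

@[simp] lemma lift_d (h : IsDownUpPair α β γ d' u') : lift h (d α β γ) = d' := by
  simp [lift, d]

@[simp] lemma lift_u (h : IsDownUpPair α β γ d' u') : lift h (u α β γ) = u' := by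
  simp [lift, u]

end Lift

variable {R : Type*} [CommRing R] (α : R) (b : Rˣ) (γ : R)

/-- The polynomials `σ ^ n (X₀)`, where `σ` is the twist. -/
noncomputable def orbit (n : ℤ) : MvPolynomial (Fin 2) R := (downUpTwist α b γ ^ n) (X 0)

lemma orbit_zero : orbit α b γ 0 = X 0 := by simp [orbit]

lemma orbit_one : orbit α b γ 1 = X 1 := by simp [orbit]

lemma orbit_rec (n : ℤ) : orbit α b γ (n + 2) =
    α • orbit α b γ (n + 1) + (b : R) • orbit α b γ n + C γ := by
  have h1 : orbit α b γ (n + 1) = (downUpTwist α b γ ^ n) (X 1) := by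
    rw [orbit, zpow_add, zpow_one, AlgEquiv.mul_apply, downUpTwist_X_zero]
  have h2 : orbit α b γ (n + 2) = (downUpTwist α b γ ^ n) (downUpTwist α b γ (X 1)) := by
    rw [orbit, zpow_add, AlgEquiv.mul_apply, ← downUpTwist_X_zero α b γ]
    rfl
  rw [h1, h2, downUpTwist_X_one, map_add, map_add, map_smul, map_smul]
  congr 1
  exact (downUpTwist α b γ ^ n).commutes γ

lemma orbit_ne_zero [Nontrivial R] (n : ℤ) : orbit α b γ n ≠ 0 := by
  rw [orbit, map_ne_zero_iff _ (AlgEquiv.injective _)]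
  exact X_ne_zero 0

/-- The operator `(d f)(n) = f (n + 1)`. -/
noncomputable def dOp (R : Type*) [CommRing R] :
    Module.End R (ℤ → MvPolynomial (Fin 2) R) :=
  LinearMap.funLeft R _ fun n : ℤ => n + 1

/-- The operator `(u f)(n) = σ ^ n (X₀) f (n - 1)`. -/
noncomputable def uOp : Module.End R (ℤ → MvPolynomial (Fin 2) R) where
  toFun f n := orbit α b γ n * f (n - 1)
  map_add' f g := by
    ext1 n
    simp [mul_add]
  map_smul' c f := by
    ext1 n
    simp

lemma dOp_apply (f : ℤ → MvPolynomial (Fin 2) R) (n : ℤ) : dOp R f n = f (n + 1) := rfl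

lemma uOp_apply (f : ℤ → MvPolynomial (Fin 2) R) (n : ℤ) :
    uOp α b γ f n = orbit α b γ n * f (n - 1) := rfl

/-- Evaluated at an integer, both relations reduce to the recurrence `orbit_rec`, at consecutive
places of the orbit. -/
lemma isDownUpPair_op : IsDownUpPair α (b : R) γ (dOp R) (uOp α b γ) where
  ddu := by
    ext1 f
    ext1 n
    simp only [pow_two, Module.End.mul_apply, LinearMap.add_apply, LinearMap.smul_apply,
      Pi.add_apply, Pi.smul_apply, dOp_apply, uOp_apply]
    have h1 : n + 1 + 1 = n + 2 := by ring
    have h2 : n + 2 - 1 = n + 1 := by ring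
    have h3 : n - 1 + 1 + 1 = n + 1 := by ring
    have h4 : n + 1 - 1 + 1 = n + 1 := by ring
    rw [h1, h2, h3, h4, orbit_rec]
    simp only [MvPolynomial.smul_eq_C_mul]
    ring
  duu := by
    ext1 f
    ext1 n
    simp only [pow_two, Module.End.mul_apply, LinearMap.add_apply, LinearMap.smul_apply,
      Pi.add_apply, Pi.smul_apply, dOp_apply, uOp_apply]
    have h1 : n + 1 - 1 = n := by ring
    have h2 : n - 1 + 1 = n := by ring
    have h3 : n - 1 - 1 + 1 = n - 1 := by ring
    have h4 : orbit α b γ (n + 1) = α • orbit α b γ n + (b : R) • orbit α b γ (n - 1) + C γ := by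
      have := orbit_rec α b γ (n - 1)
      rwa [h2, show n - 1 + 2 = n + 1 by ring] at this
    rw [h1, h2, h3, h4]
    simp only [MvPolynomial.smul_eq_C_mul]
    ring

lemma dOp_pow_apply (k : ℕ) (f : ℤ → MvPolynomial (Fin 2) R) (n : ℤ) :
    (dOp R ^ k) f n = f (n + k) := by
  induction k generalizing n with
  | zero => simp
  | succ k ih =>
    rw [pow_succ', Module.End.mul_apply, dOp_apply, ih]
    congr 1
    push_cast
    ring

lemma exists_uOp_pow_apply [IsDomain R] (k : ℕ) (n : ℤ) : ∃ c : MvPolynomial (Fin 2) R, c ≠ 0 ∧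
    ∀ f, (uOp α b γ ^ k) f n = c * f (n - k) := by
  induction k generalizing n with
  | zero => exact ⟨1, one_ne_zero, by simp⟩
  | succ k ih =>
    obtain ⟨c, hc, h⟩ := ih (n - 1)
    refine ⟨orbit α b γ n * c, mul_ne_zero (orbit_ne_zero α b γ n) hc, fun f => ?_⟩
    rw [pow_succ', Module.End.mul_apply, uOp_apply, h, mul_assoc, Nat.cast_succ, sub_sub,
      add_comm (1 : ℤ)]

/-- Evaluation at 0 after t_k sees only the value at `k`, so different `k` are separated. For
negative `k` the factor is a product of orbit terms, nonzero in a domain. -/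
lemma exists_tpow_apply [IsDomain R] (k : ℤ) : ∃ c : MvPolynomial (Fin 2) R, c ≠ 0 ∧
    ∀ f, (tpow (dOp R) (uOp α b γ) k) f 0 = c * f k := by
  cases k with
  | ofNat k => exact ⟨1, one_ne_zero, fun f => by simp [tpow, dOp_pow_apply]⟩
  | negSucc k =>
    obtain ⟨c, hc, h⟩ := exists_uOp_pow_apply α b γ (k + 1) 0
    refine ⟨c, hc, fun f => (h f).trans ?_⟩
    congr 2

lemma polyOp_apply_zero (m : Fin 2 →₀ ℕ) (f : ℤ → MvPolynomial (Fin 2) R) :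
    ((uOp α b γ * dOp R) ^ m 0 * (dOp R * uOp α b γ) ^ m 1) f 0 = monomial m 1 * f 0 := by
  have hx : ∀ (k : ℕ) (f : ℤ → MvPolynomial (Fin 2) R),
      ((uOp α b γ * dOp R) ^ k) f 0 = X 0 ^ k * f 0 := by
    intro k
    induction k with
    | zero => simp
    | succ k ih =>
      intro f
      rw [pow_succ, Module.End.mul_apply, ih, Module.End.mul_apply, uOp_apply, dOp_apply,
        orbit_zero, pow_succ, mul_assoc]
      simp
  have hy : ∀ (k : ℕ) (f : ℤ → MvPolynomial (Fin 2) R),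
      ((dOp R * uOp α b γ) ^ k) f 0 = X 1 ^ k * f 0 := by
    intro k
    induction k with
    | zero => simp
    | succ k ih =>
      intro f
      rw [pow_succ, Module.End.mul_apply, ih, Module.End.mul_apply, dOp_apply, uOp_apply,
        zero_add, orbit_one, pow_succ, mul_assoc]
      simp
  rw [Module.End.mul_apply, hx (m 0), hy (m 1), monomial_eq, Finsupp.prod_fintype _ _ (by simp),
    Fin.prod_univ_two, C_1, one_mul, mul_assoc]

/-- Let a standard monomial act on the delta functions at the integers and evaluate at 0: the
monomial (k, m) gives Xᵐ c_k at place k and 0 elsewhere. Distinct k occupy distinct places, and for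
fixed k multiplication by the nonzero c_k preserves independence of the Xᵐ. -/
theorem linearIndependent_monom [IsDomain R] :
    LinearIndependent R (monom (d α (b : R) γ) (u α b γ)) := by
  let ρ := lift (isDownUpPair_op α b γ)
  let T : DownUpAlgebra α (b : R) γ →ₗ[R] (ℤ → MvPolynomial (Fin 2) R) :=
    { toFun := fun a k => ρ a (Pi.single k 1) 0
      map_add' := fun a a' => by
        ext1 k
        simp
      map_smul' := fun c a => by
        ext1 k
        simp }
  choose c hc h using exists_tpow_apply α b γ
  refine LinearIndependent.of_comp T ?_
  have hT : T ∘ monom (d α (b : R) γ) (u α b γ) =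
      fun i : DownUpExp => Pi.single i.1 (monomial i.2 1 * c i.1) := by
    funext i
    funext k
    have hρ : ρ (monom (d α (b : R) γ) (u α b γ) i) = monom (dOp R) (uOp α b γ) i := by
      have hd : ρ (d α (b : R) γ) = dOp R := lift_d _
      have hu : ρ (u α (b : R) γ) = uOp α b γ := lift_u _
      simp only [monom, map_mul, map_pow, hd, hu]
      congr 1
      cases i.1 with
      | ofNat k => simp [tpow, hd]
      | negSucc k => simp [tpow, hu]
    change ρ (monom (d α (b : R) γ) (u α b γ) i) (Pi.single k 1) 0 = _
    rw [hρ, monom, Module.End.mul_apply, polyOp_apply_zero, h]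
    rcases eq_or_ne i.1 k with rfl | hk
    · simp
    · simp [Pi.single_eq_of_ne hk, Pi.single_eq_of_ne hk.symm]
  rw [hT]
  refine Pi.linearIndependent_single (fun k (m : Fin 2 →₀ ℕ) => monomial m (1 : R) * c k)
    fun k => ?_
  have hinj : LinearMap.ker (LinearMap.mulRight R (c k)) = ⊥ :=
    LinearMap.ker_eq_bot.mpr (mul_left_injective₀ (hc k))
  have := (basisMonomials (Fin 2) R).linearIndependent.map' _ hinj
  simpa [Function.comp_def] using this

end DownUpAlgebra

/-! ### Bases of associated graded rings -/

namespace NFiltration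

variable {R A : Type*} [CommRing R] [Ring A] [Algebra R A] (F : NFiltration R A)

/-- The element `z` of the associated graded ring is the symbol of `a` in degree `n`. -/
def IsSymbol (n : ℕ) (a : A) (z : F.AssocGraded) : Prop := ∃ ha, z = F.grOf n (F.symbol n a ha)

variable {F}

/-- As `IsSymbol` is a relation, degrees and elements can be rewritten along equalities without
transport between graded pieces. -/
lemma IsSymbol.mul {m n : ℕ} {a b : A} {z w : F.AssocGraded} (hz : F.IsSymbol m a z)
    (hw : F.IsSymbol n b w) : F.IsSymbol (m + n) (a * b) (z * w) := by
  obtain ⟨ha, rfl⟩ := hz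
  obtain ⟨hb, rfl⟩ := hw
  exact ⟨F.mul_mem' ha hb, F.grOf_mul _ _⟩

lemma IsSymbol.one : F.IsSymbol 0 1 1 := ⟨F.one_mem', rfl⟩

lemma IsSymbol.pow {n : ℕ} {a : A} {z : F.AssocGraded} (hz : F.IsSymbol n a z) (k : ℕ) :
    F.IsSymbol (n * k) (a ^ k) (z ^ k) := by
  induction k with
  | zero => simpa using IsSymbol.one
  | succ k ih =>
    rw [pow_succ, pow_succ, Nat.mul_succ]
    exact ih.mul hz

lemma IsSymbol.add {n : ℕ} {a b : A} {z w : F.AssocGraded} (hz : F.IsSymbol n a z)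
    (hw : F.IsSymbol n b w) : F.IsSymbol n (a + b) (z + w) := by
  obtain ⟨ha, rfl⟩ := hz
  obtain ⟨hb, rfl⟩ := hw
  exact ⟨add_mem ha hb, by rw [← map_add]; rfl⟩

lemma IsSymbol.smul {n : ℕ} {a : A} {z : F.AssocGraded} (hz : F.IsSymbol n a z) (c : R) :
    F.IsSymbol n (c • a) (c • z) := by
  obtain ⟨ha, rfl⟩ := hz
  exact ⟨Submodule.smul_mem _ c ha, by rw [← map_smul]; rfl⟩

lemma IsSymbol.eq {n : ℕ} {a b : A} {z w : F.AssocGraded} (hz : F.IsSymbol n a z)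
    (hw : F.IsSymbol n b w) (hab : a - b ∈ F.prev n) : z = w := by
  obtain ⟨ha, rfl⟩ := hz
  obtain ⟨hb, rfl⟩ := hw
  rw [(F.symbol_eq_iff ha hb).mpr hab]

lemma mem_prev_of_lt {m n : ℕ} (hmn : m < n) {a : A} (ha : a ∈ F.toFun m) : a ∈ F.prev n := by
  cases n with
  | zero => omega
  | succ n => exact monotone_nat_of_le_succ F.mono' (Nat.lt_succ_iff.mp hmn) ha

lemma finite_grPiece (n : ℕ) [Module.Finite R (F.toFun n)] : Module.Finite R (F.GrPiece n) :=
  inferInstanceAs (Module.Finite R (F.toFun n ⧸ (F.prev n).submoduleOf (F.toFun n)))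

section Basis

variable {ι : Type*} (b : Module.Basis ι R A) (deg : ι → ℕ)
  (hF : ∀ n, F.toFun n = Submodule.span R (b '' {i | deg i ≤ n}))

include hF in
lemma basis_mem (i : ι) : b i ∈ F.toFun (deg i) := by
  rw [hF]
  exact Submodule.subset_span ⟨i, le_refl (deg i), rfl⟩

include hF in
-- This lets the degree `n` coordinates descend to the quotient by the previous step.
lemma filter_repr_eq_zero_of_mem_prev {n : ℕ} {a : A} (ha : a ∈ F.prev n) :
    (b.repr a).filter (fun i => deg i = n) = 0 := by
  cases n with
  | zero =>
    have h0 : a = 0 := ha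
    rw [h0, map_zero]
    exact Finsupp.filter_zero _
  | succ n =>
    change a ∈ F.toFun n at ha
    rw [hF, Module.Basis.mem_span_image] at ha
    rw [Finsupp.filter_eq_zero_iff]
    intro i hi
    by_contra hne
    have : deg i ≤ n := ha (Finsupp.mem_support_iff.mpr hne)
    omega

/-- The coordinates, of degree `n`, of an element of the `n`-th graded piece. -/
noncomputable def grPieceRepr (n : ℕ) : F.GrPiece n →ₗ[R] (ι →₀ R) :=
  Submodule.liftQ _
    { toFun := fun a => (b.repr a.1).filter fun i => deg i = n
      map_add' := fun a a' => by
        rw [Submodule.coe_add, map_add, Finsupp.filter_add]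
      map_smul' := fun c a => by
        rw [Submodule.coe_smul, map_smul, Finsupp.filter_smul, RingHom.id_apply] }
    (fun a ha => filter_repr_eq_zero_of_mem_prev b deg hF ha)

/-- The symbols of a basis adapted to a filtration are a basis of the associated graded ring. -/
noncomputable def grBasis : Module.Basis ι R F.AssocGraded :=
  Module.Basis.mk (v := fun i => F.grOf (deg i) (F.symbol (deg i) (b i) (basis_mem b deg hF i)))
    (by
      -- Reading off coordinates of the right degree sends the symbol of `b i` to the unit vector at
      -- `i`, which gives independence.
      let T : F.AssocGraded →ₗ[R] (ι →₀ R) :=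
        DirectSum.toModule R ℕ (ι →₀ R) fun n => grPieceRepr b deg hF n
      refine LinearIndependent.of_comp T ?_
      convert Finsupp.linearIndependent_single_one R ι using 1
      funext i
      refine (DirectSum.toModule_lof R (deg i) _).trans ?_
      change (b.repr (b i)).filter (fun j => deg j = deg i) = _
      rw [Module.Basis.repr_self, Finsupp.filter_single_of_pos (fun j => deg j = deg i) rfl])
    (by
      rintro z -
      set M := Submodule.span R (Set.range fun i =>
        F.grOf (deg i) (F.symbol (deg i) (b i) (basis_mem b deg hF i)))
      have key : ∀ n a (ha : a ∈ F.toFun n), F.grOf n (F.symbol n a ha) ∈ M := by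
        intro n a ha
        have ha' := ha
        rw [hF] at ha'
        -- The existential form frees the span induction from a fixed membership proof; a basis
        -- vector of degree below `n` contributes the zero symbol.
        have hex : ∃ z ∈ M, F.IsSymbol n a z := by
          clear ha
          induction ha' using Submodule.span_induction with
          | mem a h =>
            obtain ⟨i, hi, rfl⟩ := h
            rcases (show deg i ≤ n from hi).eq_or_lt with rfl | hlt
            · exact ⟨_, Submodule.subset_span ⟨i, rfl⟩, _, rfl⟩
            · have hp : b i ∈ F.prev n := mem_prev_of_lt hlt (basis_mem b deg hF i)
              have hm : b i ∈ F.toFun n :=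
                monotone_nat_of_le_succ F.mono' hlt.le (basis_mem b deg hF i)
              refine ⟨0, zero_mem _, hm, ?_⟩
              have h0 : F.symbol n (b i) hm = 0 := by
                rw [symbol_zero, symbol_eq_iff, sub_zero]
                exact hp
              rw [h0, map_zero]
          | zero => exact ⟨0, zero_mem _, zero_mem _, (map_zero (F.grOf n)).symm⟩
          | add x y _ _ hx hy =>
            obtain ⟨z, hz, hz'⟩ := hx
            obtain ⟨w, hw, hw'⟩ := hy
            exact ⟨z + w, add_mem hz hw, hz'.add hw'⟩
          | smul c x _ hx =>
            obtain ⟨z, hz, hz'⟩ := hx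
            exact ⟨c • z, Submodule.smul_mem _ c hz, hz'.smul c⟩
        obtain ⟨z, hz, _, rfl⟩ := hex
        exact hz
      induction z using DirectSum.induction_on with
      | zero => exact zero_mem M
      | of n x =>
        obtain ⟨a, ha, rfl⟩ := F.symbol_surj x
        exact key n a ha
      | add x y hx hy => exact add_mem hx hy)

lemma grBasis_apply (i : ι) :
    grBasis b deg hF i = F.grOf (deg i) (F.symbol (deg i) (b i) (basis_mem b deg hF i)) :=
  Module.Basis.mk_apply _ _ i

end Basis

end NFiltration

/-- A homomorphism that maps a basis to a basis identifies its source with an order. -/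
lemma IsOrderMap.of_basis {𝕜 : Type*} [Field 𝕜] {D : Subring 𝕜} {A B ι : Type*} [Ring A]
    [Algebra 𝕜 A] [Ring B] [Algebra D B] {f : B →ₐ[D] A} (bB : Module.Basis ι D B)
    (bA : Module.Basis ι 𝕜 A) (h : ∀ i, f (bB i) = bA i) : IsOrderMap f := by
  have hf : ∀ x, f x = Finsupp.linearCombination D bA (bB.repr x) := by
    have : f.toLinearMap = (Finsupp.linearCombination D bA) ∘ₗ bB.repr.toLinearMap :=
      bB.ext fun i => by simp [h]
    exact fun x => LinearMap.congr_fun this x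
  have hli : LinearIndependent D bA :=
    bA.linearIndependent.restrict_scalars (by
      intro c c' hcc
      simpa [Subring.smul_def] using hcc)
  refine ⟨fun x y hxy => ?_, Module.Free.of_basis bB, ?_⟩
  · refine bB.repr.injective
      ((linearIndependent_iff_injective_finsuppLinearCombination.mp hli) ?_)
    rwa [← hf, ← hf]
  · let e : 𝕜 ⊗[D] B ≃ₗ[𝕜] A := (bB.baseChange 𝕜).equiv bA (Equiv.refl ι)
    have he : (e.toLinearMap.restrictScalars D) ∘ₗ (TensorProduct.mk D 𝕜 B 1) =
        f.toLinearMap := by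
      refine bB.ext fun i => ?_
      change e (1 ⊗ₜ bB i) = f (bB i)
      rw [h, ← Module.Basis.baseChange_apply, Module.Basis.equiv_apply]
      rfl
    exact IsBaseChange.of_equiv e fun x => LinearMap.congr_fun he x

/-! ### Base change of down-up pairs -/

namespace IsDownUpPair

open DownUpExp

section BaseChange

variable {R S : Type*} [CommRing R] [Ring S] [Algebra R S] {α β γ : R} {d u : S}

lemma baseChange (h : IsDownUpPair α β γ d u) (C : Type*) [CommRing C] [Algebra R C] :
    IsDownUpPair (algebraMap R C α) (algebraMap R C β) (algebraMap R C γ)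
      ((1 : C) ⊗ₜ[R] d) ((1 : C) ⊗ₜ[R] u) where
  ddu := by
    have := congrArg (Algebra.TensorProduct.includeRight : S →ₐ[R] C ⊗[R] S) h.ddu
    simpa only [map_mul, map_pow, map_add, map_smul, algebraMap_smul,
      Algebra.TensorProduct.includeRight_apply] using this
  duu := by
    have := congrArg (Algebra.TensorProduct.includeRight : S →ₐ[R] C ⊗[R] S) h.duu
    simpa only [map_mul, map_pow, map_add, map_smul, algebraMap_smul,
      Algebra.TensorProduct.includeRight_apply] using this

end BaseChange

end IsDownUpPair

lemma Algebra.adjoin_one_tmul_pair_eq_top {R S : Type*} [CommRing R] [Ring S] [Algebra R S]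
    {d u : S} (hgen : Algebra.adjoin R {d, u} = ⊤) (C : Type*) [CommRing C] [Algebra R C] :
    Algebra.adjoin C {(1 : C) ⊗ₜ[R] d, (1 : C) ⊗ₜ[R] u} = ⊤ := by
  set T := Algebra.adjoin C {(1 : C) ⊗ₜ[R] d, (1 : C) ⊗ₜ[R] u}
  refine Algebra.eq_top_iff.mpr ?_
  intro z
  induction z using TensorProduct.induction_on with
  | zero => exact zero_mem T
  | add x y hx hy => exact add_mem hx hy
  | tmul c a =>
    have ha : a ∈ Algebra.adjoin R {d, u} := by
      rw [hgen]
      trivial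
    have h1 : Algebra.adjoin R {d, u} ≤ (T.restrictScalars R).comap
        (Algebra.TensorProduct.includeRight : S →ₐ[R] C ⊗[R] S) := by
      refine Algebra.adjoin_le ?_
      rintro _ (rfl | rfl)
      · exact Algebra.subset_adjoin (Or.inl rfl)
      · exact Algebra.subset_adjoin (Or.inr rfl)
    have h2 : (1 : C) ⊗ₜ[R] a ∈ T := h1 ha
    have h3 : c ⊗ₜ[R] a = c • ((1 : C) ⊗ₜ[R] a) := by
      rw [TensorProduct.smul_tmul', smul_eq_mul, mul_one]
    rw [h3]
    exact T.smul_mem h2 c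

lemma IsLeftRightNoetherian.of_ringEquiv {S T : Type*} [Ring S] [Ring T] (e : S ≃+* T)
    (h : IsLeftRightNoetherian S) : IsLeftRightNoetherian T := by
  obtain ⟨h1, h2⟩ := h
  exact ⟨isNoetherianRing_of_ringEquiv S e, isNoetherianRing_of_ringEquiv _ e.op⟩

namespace IsDownUpPair

variable {R S : Type*} [CommRing R] [Ring S] [Algebra R S] {α γ : R} {b : Rˣ} {d u : S}

/-- Relations, generation and invertibility of β all survive base change, so the theorem over a
general base ring applies to `C`. -/
theorem isLeftRightNoetherian_baseChange (h : IsDownUpPair α b γ d u)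
    (hgen : Algebra.adjoin R {d, u} = ⊤) (C : Type*) [CommRing C] [Algebra R C]
    [IsNoetherianRing C] : IsLeftRightNoetherian (C ⊗[R] S) :=
  isLeftRightNoetherian (b := Units.map (algebraMap R C : R →* C) b) (h.baseChange C)
    (Algebra.adjoin_one_tmul_pair_eq_top hgen C)

theorem isPIAlgebra_baseChange (h : IsDownUpPair α b γ d u)
    (hgen : Algebra.adjoin R {d, u} = ⊤) (C : Type*) [CommRing C] [Algebra R C]
    [Finite C] [Nontrivial C] : IsPIAlgebra C (C ⊗[R] S) :=
  isPIAlgebra (b := Units.map (algebraMap R C : R →* C) b) (h.baseChange C)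
    (Algebra.adjoin_one_tmul_pair_eq_top hgen C)

/-- An algebra generated by a down-up pair with `β` invertible is strongly noetherian. -/
theorem isStronglyNoetherian (h : IsDownUpPair α b γ d u) (hgen : Algebra.adjoin R {d, u} = ⊤) :
    IsStronglyNoetherian.{v} R S := by
  intro C _ _ hC
  exact (h.isLeftRightNoetherian_baseChange hgen C).of_ringEquiv
    (Algebra.TensorProduct.comm R C S).toRingEquiv

end IsDownUpPair

/-! ### Congeniality -/

namespace IsDownUpPair

open DownUpExp NFiltration

section Graded

variable {R A : Type*} [CommRing R] [Ring A] [Algebra R A] {α β γ : R} {d u : A}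
  {F : NFiltration R A}

lemma isSymbol_monom {d' u' : F.AssocGraded} (hd : F.IsSymbol 1 d d') (hu : F.IsSymbol 1 u u')
    (i : DownUpExp) : F.IsSymbol i.deg (monom d u i) (monom d' u' i) := by
  have ht : F.IsSymbol i.1.natAbs (tpow d u i.1) (tpow d' u' i.1) := by
    cases i.1 with
    | ofNat k => simpa [tpow] using hd.pow k
    | negSucc k => simpa [tpow] using hu.pow (k + 1)
  have hdeg : i.deg = 2 * i.2 0 + 2 * i.2 1 + i.1.natAbs := by
    rw [deg, Finsupp.degree_eq_sum, Fin.sum_univ_two, mul_add]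
  rw [hdeg]
  exact (((hu.mul hd).pow _).mul ((hd.mul hu).pow _)).mul ht

/-- The symbols in degree one of a down-up pair satisfy the homogeneous down-up relations. -/
lemma symbol (h : IsDownUpPair α β γ d u) {d' u' : F.AssocGraded} (hd : F.IsSymbol 1 d d')
    (hu : F.IsSymbol 1 u u') : IsDownUpPair α β 0 d' u' where
  ddu := by
    -- The relation lives in degree 3 while γd has degree 1, so the linear term is represented by
    -- zero.
    have hγ : F.IsSymbol 3 0 ((0 : R) • d') := by
      rw [zero_smul]
      exact ⟨zero_mem _, (map_zero (F.grOf 3)).symm⟩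
    refine ((hd.pow 2).mul hu).eq
      (((((hd.mul hu).mul hd).smul α).add ((hu.mul (hd.pow 2)).smul β)).add hγ) ?_
    rw [h.ddu, add_zero, add_sub_cancel_left]
    exact Submodule.smul_mem _ _ (mem_prev_of_lt (by norm_num : 1 < 3) hd.choose)
  duu := by
    have hγ : F.IsSymbol 3 0 ((0 : R) • u') := by
      rw [zero_smul]
      exact ⟨zero_mem _, (map_zero (F.grOf 3)).symm⟩
    refine (hd.mul (hu.pow 2)).eq
      (((((hu.mul hd).mul hu).smul α).add (((hu.pow 2).mul hd).smul β)).add hγ) ?_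
    rw [h.duu, add_zero, add_sub_cancel_left]
    exact Submodule.smul_mem _ _ (mem_prev_of_lt (by norm_num : 1 < 3) hu.choose)

end Graded

lemma adjoin_restrict_eq_top {R A : Type*} [CommRing R] [Ring A] [Algebra R A] (d u : A) :
    Algebra.adjoin R {(⟨d, Algebra.subset_adjoin (Or.inl rfl)⟩ : Algebra.adjoin R {d, u}),
      ⟨u, Algebra.subset_adjoin (Or.inr rfl)⟩} = ⊤ := by
  refine Eq.trans ?_ (Algebra.adjoin_adjoin_coe_preimage (R := R) (s := {d, u}))
  congr 1
  ext ⟨z, hz⟩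
  simp [Subtype.ext_iff]

/-- Let `A` be an algebra generated by a down-up pair with `β` invertible whose standard monomials
are linearly independent. Over a finitely generated ring of definition of the parameters in which
`β` is invertible, the subalgebra generated by the pair is an order that witnesses that `A` is
congenial. -/
theorem isCongenialOrder {𝕜 : Type u} [Field 𝕜] {A : Type w} [Ring A] [Algebra 𝕜 A]
    {D : Subring 𝕜} (hD : Algebra.FiniteType ℤ D) {α γ : D} {b : Dˣ} {d u : A}
    (h : IsDownUpPair (α : 𝕜) ((b : D) : 𝕜) (γ : 𝕜) d u) (hgen : Algebra.adjoin 𝕜 {d, u} = ⊤)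
    (hli : LinearIndependent 𝕜 (monom d u)) :
    IsCongenialOrder.{v} (NFiltration.ofGenerators {d, u} hgen)
      (Algebra.adjoin D ({d, u} : Set A)) := by
  set F := NFiltration.ofGenerators {d, u} hgen
  let B := Algebra.adjoin D ({d, u} : Set A)
  let dB : B := ⟨d, Algebra.subset_adjoin (Or.inl rfl)⟩
  let uB : B := ⟨u, Algebra.subset_adjoin (Or.inr rfl)⟩
  have hgenB : Algebra.adjoin D {dB, uB} = ⊤ := adjoin_restrict_eq_top d u
  have hB : IsDownUpPair α b γ dB uB := ⟨Subtype.ext h.ddu, Subtype.ext h.duu⟩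
  have hmon : ∀ i, ((monom dB uB i : B) : A) = monom d u i := by
    intro i
    simp only [monom, MulMemClass.coe_mul, SubmonoidClass.coe_pow]
    congr 1
    cases i.1 <;> rfl
  let bU : 𝕜ˣ := Units.map (D.subtype : D →* 𝕜) b
  have h' : IsDownUpPair (α : 𝕜) (bU : 𝕜) (γ : 𝕜) d u := h
  let bA : Module.Basis DownUpExp 𝕜 A := Module.Basis.mk hli (by
    rw [h'.span_monom_eq_adjoin, hgen]
    rfl)
  have hbA : ∀ i, bA i = monom d u i := Module.Basis.mk_apply hli _
  have hliB : LinearIndependent D (monom dB uB) := by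
    refine LinearIndependent.of_comp B.val.toLinearMap ?_
    have h1 : B.val.toLinearMap ∘ monom dB uB = monom d u := funext hmon
    rw [h1]
    exact hli.restrict_scalars (by
      intro c c' hcc
      simpa [Subring.smul_def] using hcc)
  let bB : Module.Basis DownUpExp D B := Module.Basis.mk hliB (by
    rw [hB.span_monom_eq_adjoin, hgenB]
    rfl)
  have hbB : ∀ i, bB i = monom dB uB i := Module.Basis.mk_apply hliB _
  have hbBA : ∀ i, ((bB i : B) : A) = bA i := fun i => by rw [hbB, hbA, hmon]
  have hFA : ∀ n, F.toFun n = Submodule.span 𝕜 (bA '' {i | i.deg ≤ n}) := by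
    intro n
    have h1 : (bA : DownUpExp → A) = monom d u := funext hbA
    rw [h1]
    exact h'.span_pow_eq n
  -- Coordinates over `D` and over the field agree, and membership in a filtration step depends only
  -- on their support. Hence intersecting `F n` with `B` gives no more than the `D`-span of the
  -- monomials of degree at most `n`.
  have hrepr : ∀ (a : B) (i : DownUpExp), bA.repr (a : A) i = ((bB.repr a i : D) : 𝕜) := by
    intro a i
    have h1 : (a : A) = ∑ j ∈ (bB.repr a).support, ((bB.repr a j : D) : 𝕜) • bA j := by
      conv_lhs => rw [← bB.linearCombination_repr a, Finsupp.linearCombination_apply,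
        Finsupp.sum, AddSubmonoidClass.coe_finsetSum]
      exact Finset.sum_congr rfl fun j _ => by rw [← hbBA]; rfl
    conv_lhs => rw [h1, map_sum, Finsupp.finsetSum_apply]
    simp only [map_smul, Module.Basis.repr_self, Finsupp.smul_apply, smul_eq_mul,
      Finsupp.single_apply, mul_ite, mul_one, mul_zero, Finset.sum_ite_eq']
    split_ifs with hi
    · rfl
    · simp [Finsupp.notMem_support_iff.mp hi]
  have hFB : ∀ n, (F.induced B).toFun n = Submodule.span D (bB '' {i | i.deg ≤ n}) := by
    intro n
    ext a
    rw [F.mem_induced, hFA, Module.Basis.mem_span_image, Module.Basis.mem_span_image]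
    have h1 : ((bA.repr (a : A)).support : Set DownUpExp) = (bB.repr a).support := by
      ext i
      simp [hrepr]
    rw [h1]
  have hfin : ∀ n, Module.Finite D ((F.induced B).toFun n) := by
    intro n
    rw [hFB]
    exact Module.Finite.span_of_finite D ((DownUpExp.finite_deg_le n).image bB)
  have hd1 : dB ∈ (F.induced B).toFun 1 := by
    change d ∈ Submodule.span 𝕜 (insert 1 {d, u}) ^ 1
    rw [pow_one]
    exact Submodule.subset_span (Or.inr (Or.inl rfl))
  have hu1 : uB ∈ (F.induced B).toFun 1 := by
    change u ∈ Submodule.span 𝕜 (insert 1 {d, u}) ^ 1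
    rw [pow_one]
    exact Submodule.subset_span (Or.inr (Or.inr rfl))
  let dG := (F.induced B).grOf 1 ((F.induced B).symbol 1 dB hd1)
  let uG := (F.induced B).grOf 1 ((F.induced B).symbol 1 uB hu1)
  have hdG : (F.induced B).IsSymbol 1 dB dG := ⟨hd1, rfl⟩
  have huG : (F.induced B).IsSymbol 1 uB uG := ⟨hu1, rfl⟩
  have hG : IsDownUpPair α b 0 dG uG := hB.symbol hdG huG
  let gB := grBasis bB DownUpExp.deg hFB
  have hgB : ∀ i, gB i = monom dG uG i := by
    intro i
    refine (grBasis_apply bB DownUpExp.deg hFB i).trans ?_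
    refine IsSymbol.eq ⟨basis_mem bB _ hFB i, rfl⟩ (isSymbol_monom hdG huG i) ?_
    rw [hbB, sub_self]
    exact zero_mem _
  -- Symbols of standard monomials are standard monomials in the two degree-one symbols, so these
  -- generate the graded ring.
  have hgenG : Algebra.adjoin D {dG, uG} = ⊤ := by
    rw [← Algebra.toSubmodule_eq_top, ← hG.span_monom_eq_adjoin, ← gB.span_eq]
    congr 2
    exact (funext hgB).symm
  refine
    { affine := hD
      order := IsOrderMap.of_basis bB bA hbBA
      locallyFinite := hfin
      gr_order := IsOrderMap.of_basis gB (grBasis bA DownUpExp.deg hFA) fun i => ?_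
      gr_stronglyNoetherian := hG.isStronglyNoetherian hgenG
      gr_locallyFinite := fun n => ?_
      affine_residue := fun I _ _ => ?_
      noetherian_residue := fun I _ _ => ?_
      pi_residue := fun I hI _ => ?_ }
  · rw [grBasis_apply, grBasis_apply, F.grMap_grOf_symbol]
    congr 2
    exact hbBA i
  · have := hfin n
    exact finite_grPiece n
  · exact ⟨Subalgebra.fg_def.mpr
      ⟨_, Set.toFinite _, Algebra.adjoin_one_tmul_pair_eq_top hgenB (D ⧸ I)⟩⟩
  · exact hB.isLeftRightNoetherian_baseChange hgenB (D ⧸ I)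
  · have := hI.nontrivial
    exact hB.isPIAlgebra_baseChange hgenB (D ⧸ I)

end IsDownUpPair

lemma exists_finiteType_subring {𝕜 : Type*} [Field 𝕜] (s : Finset 𝕜) :
    ∃ D : Subring 𝕜, (s : Set 𝕜) ⊆ D ∧ Algebra.FiniteType ℤ D := by
  let E := Algebra.adjoin ℤ (s : Set 𝕜)
  refine ⟨E.toSubring, Algebra.subset_adjoin, ?_⟩
  have h1 : Algebra.FiniteType ℤ E := E.fg_iff_finiteType.mp ⟨s, rfl⟩
  exact Algebra.FiniteType.of_surjective
    (RingHom.toIntAlgHom (RingHom.id E : E →+* E.toSubring)) fun x => ⟨x, rfl⟩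

theorem mainTheorem7 {𝕜 : Type u} [Field 𝕜] [IsAlgClosed 𝕜] [CharZero 𝕜]
    (α β γ r s : 𝕜) (hβ : β ≠ 0)
    (hroots : (Polynomial.X ^ 2 - Polynomial.C α * Polynomial.X - Polynomial.C β).roots = {r, s})
    (hr : IsOfFinOrder r) (hr2 : 2 ≤ orderOf r)
    (hs : IsOfFinOrder s) (hs2 : 2 ≤ orderOf s) :
    IsCongenial.{v} (DownUpAlgebra.standardFiltration α β γ) := by
  classical
  refine ⟨fun n => Module.Finite.of_fg (Submodule.FG.pow
    (Submodule.fg_span (Set.toFinite _)) n), ?_⟩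
  -- Including `β⁻¹` makes β a unit of `D`, so the twist is invertible over `D` and over each of its
  -- quotients.
  obtain ⟨D, hsD, hD⟩ := exists_finiteType_subring {α, β, β⁻¹, γ}
  have hα : α ∈ D := hsD (by simp)
  have hb : β ∈ D := hsD (by simp)
  have hb' : β⁻¹ ∈ D := hsD (by simp)
  have hγ : γ ∈ D := hsD (by simp)
  let b : Dˣ := ⟨⟨β, hb⟩, ⟨β⁻¹, hb'⟩, Subtype.ext (mul_inv_cancel₀ hβ),
    Subtype.ext (inv_mul_cancel₀ hβ)⟩
  exact ⟨D, _, IsDownUpPair.isCongenialOrder (α := ⟨α, hα⟩) (γ := ⟨γ, hγ⟩) (b := b) hD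
    (DownUpAlgebra.isDownUpPair α β γ) (DownUpAlgebra.adjoin_d_u α β γ)
    (DownUpAlgebra.linearIndependent_monom α (Units.mk0 β hβ) γ)⟩
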